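/- Setting. Let $N\cong\mathbb Z^d$ be a lattice with dual lattice $M$, let $\Sigma$ be a fan in $N_{\mathbb R}$ whose toric variety $X_\Sigma$ (of dimension $d$) is smooth and projective, and let $\mathbf v_\rho$ be the primitive generator of a ray $\rho\in\Sigma(1)$. Let $\mathcal M$ be a loop-free matroid on a finite nonempty ground set. $\mathrm{Berg}(\mathcal M)\subset\mathbb R^{\mathcal M}$ is the set of all $w$ such that on each circuit the minimum of the coordinates of $w$ is attained at least twice; for a basis $B$, the apartment $A_B$ is the set of those $w\in\mathrm{Berg}(\mathcal M)$ for which $\sum_{e\in B'}w_e\le\sum_{e\in B}w_e$ for all bases $B'$ (the intersection of $\mathrm{Berg}(\mathcal M)$ with the outer normal cone of the matroid polytope at the vertex of $B$); it is identified with $\mathbb R^B$ by projection. A tropical toric vector bundle $\mathfrak E$ on $X_\Sigma$ with matroid $\mathcal M$ is a map $\Phi=(\mathfrak v(e))_{e\in\mathcal M}:|\Sigma|\to\mathrm{Berg}(\mathcal M)$, with integer values on $N$, such that each cone $\sigma\in\Sigma$ has a basis $B$ with $\Phi(\sigma)\subset A_B$ and $\Phi|_\sigma$ linear as a map to $A_B\cong\mathbb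 R^B$. A $T$-linearized line bundle $\mathcal L=\mathcal O(\psi)$ is an integral piecewise linear function $\psi$ on $\Sigma$; it is ample if $\Sigma$ is the outer normal fan of $\{y\in M_{\mathbb R}\mid\langle y,\mathbf v_\rho\rangle\le\psi(\mathbf v_\rho)\ \forall\rho\in\Sigma(1)\}$. The bundle $\mathfrak E\otimes\mathcal L^{\otimes n}$ is given by the functions $\mathfrak v(e)+n\psi$. For $u\in M$ and $\sigma\in\Sigma$ let $H^0(U_\sigma,\mathfrak E)_u$ and $H^0(X_\Sigma,\mathfrak E)_u$ be the restrictions of $\mathcal M$ to the sets of those $e\in\mathcal M$ with $\langle u,\mathbf v_\rho\rangle\le\mathfrak v(e)(\mathbf v_\rho)$ for all rays $\rho$ of $\sigma$, respectively for all $\rho\in\Sigma(1)$, and put $$\chi(X_\Sigma,\mathfrak E)_u=\sum_{\sigma\in\Sigma}(-1)^{\operatorname{codim}\sigma}\operatorname{rank}H^0(U_\sigma,\mathfrak E)_u,\qquad h^0(X_\Sigma,\mathfrak E)=\sum_{u\in M}\operatorname{rank}H^0(X_\Sigma,\mathfrak E)_u .$$ Theorem. Let $\mathfrak E$ be a tropical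 toric vector bundle with matroid $\mathcal M$ on the smooth projective toric variety $X_\Sigma$, and let $\mathcal L$ be an ample line bundle on $X_\Sigma$. Then there is an integer $N_0>0$ such that for all integers $n\ge N_0$ and all $u\in M$ $$\chi(X_\Sigma,\mathfrak E\otimes\mathcal L^{\otimes n})_u=\operatorname{rank}H^0(X_\Sigma,\mathfrak E\otimes\mathcal L^{\otimes n})_u .$$ Moreover, there is a polynomial $p\in\mathbb Q[t]$ of degree exactly $d=\dim X_\Sigma$, taking integer values at all integers, such that for all $n\ge N_0$ only finitely many of the ranks of $H^0(X_\Sigma,\mathfrak E\otimes\mathcal L^{\otimes n})_u$, $u\in M$, are nonzero and $h^0(X_\Sigma,\mathfrak E\otimes\mathcal L^{\otimes n})=p(n)$. -/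

import Mathlib

noncomputable section

/-- The real point of `N_ℝ = ℝ^d` (or of `M_ℝ = ℝ^d`) given by a lattice point. The lattices
`N = ℤ^d` and `M = Hom(N, ℤ) = ℤ^d` are paired by the dot product. -/
def latticePt {d : ℕ} (v : Fin d → ℤ) : Fin d → ℝ := fun i => (v i : ℝ)

/-- A lattice vector is primitive if it is not a proper multiple of a lattice vector
(in particular it is nonzero, as `0 = 2 • 0`). -/
def IsPrimitiveVec {d : ℕ} (v : Fin d → ℤ) : Prop :=
  ∀ (k : ℤ) (w : Fin d → ℤ), v = k • w → IsUnit k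

/-- The outer normal cone at the point `y` of a set `P`: the linear functionals
(identified with vectors by the dot product) whose maximum on `P` is attained at `y`. -/
def normalCone {ι : Type*} [Fintype ι] (P : Set (ι → ℝ)) (y : ι → ℝ) :
    PointedCone ℝ (ι → ℝ) where
  carrier := {x | ∀ y' ∈ P, y' ⬝ᵥ x ≤ y ⬝ᵥ x}
  add_mem' := by
    intro a b ha hb y' hy'
    rw [dotProduct_add, dotProduct_add]
    exact add_le_add (ha y' hy') (hb y' hy')
  zero_mem' := by
    intro y' _
    simp
  smul_mem' := by
    intro c x hx y' hy'
    have h1 : ∀ z : ι → ℝ, z ⬝ᵥ (c • x) = (c : ℝ) * (z ⬝ᵥ x) := by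
      intro z
      have : c • x = (c : ℝ) • x := rfl
      rw [this, dotProduct_smul, smul_eq_mul]
    rw [h1, h1]
    exact mul_le_mul_of_nonneg_left (hx y' hy') c.2

/-- The outer normal fan of a polyhedron `P`: the set of the outer normal cones of its nonempty
faces. (The normal cone of a face is the normal cone at any of its relative interior points.) -/
def outerNormalFan {ι : Type*} [Fintype ι] (P : Set (ι → ℝ)) : Set (PointedCone ℝ (ι → ℝ)) :=
  {C | ∃ y ∈ P, C = normalCone P y}

/-! ### Fans -/

/-- A (finite, nonempty) fan of strongly convex rational polyhedral cones in `N_ℝ = ℝ^d`. -/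
structure ToricFan (d : ℕ) where
  cones : Finset (PointedCone ℝ (Fin d → ℝ))
  nonempty : cones.Nonempty
  rational : ∀ σ ∈ cones, ∃ s : Finset (Fin d → ℤ),
    σ = PointedCone.hull ℝ (latticePt '' (s : Set (Fin d → ℤ)))
  stronglyConvex : ∀ σ ∈ cones, ∀ x, x ∈ σ → -x ∈ σ → x = 0
  face_mem : ∀ σ ∈ cones, ∀ τ : PointedCone ℝ (Fin d → ℝ), τ.IsFaceOf σ → τ ∈ cones
  inter_face : ∀ σ ∈ cones, ∀ τ ∈ cones, (σ ⊓ τ).IsFaceOf σ ∧ (σ ⊓ τ).IsFaceOf τ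

/-- The codimension of a cone in `ℝ^d`; its dimension is that of its linear span. -/
def coneCodim {d : ℕ} (σ : PointedCone ℝ (Fin d → ℝ)) : ℕ :=
  d - Module.finrank ℝ (Submodule.span ℝ (σ : Set (Fin d → ℝ)))

namespace ToricFan

variable {d : ℕ} (S : ToricFan d)

/-- The support `|Σ|`. -/
def support : Set (Fin d → ℝ) := {x | ∃ σ ∈ S.cones, x ∈ σ}

/-- The rays of the fan, each represented by its primitive generator `v_ρ`. -/
def rays : Set (Fin d → ℤ) := {v | IsPrimitiveVec v ∧ PointedCone.hull ℝ {latticePt v} ∈ S.cones}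

/-- The rays `σ(1)` of a cone `σ` of the fan, again as primitive generators. -/
def raysOf (σ : PointedCone ℝ (Fin d → ℝ)) : Set (Fin d → ℤ) := {v ∈ S.rays | latticePt v ∈ σ}

/-- `X_Σ` is complete. -/
def IsComplete : Prop := ∀ x, x ∈ S.support

/-- `X_Σ` is smooth: each cone is generated by a part of a basis of the lattice `N`. -/
def IsSmooth : Prop :=
  ∀ σ ∈ S.cones, ∃ (b : Module.Basis (Fin d) ℤ (Fin d → ℤ)) (s : Set (Fin d)),
    σ = PointedCone.hull ℝ ((fun i => latticePt (b i)) '' s)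

end ToricFan

/-! ### Toric line bundles -/

/-- A `T`-linearized line bundle `O(ψ)` on `X_Σ`: an integral piecewise linear function `ψ` on
`|Σ|`, linear on the cones of `Σ`. -/
structure ToricLineBundle {d : ℕ} (S : ToricFan d) where
  psi : (Fin d → ℝ) → ℝ
  linearOn : ∀ σ ∈ S.cones, ∃ l : (Fin d → ℝ) →ₗ[ℝ] ℝ, ∀ x ∈ σ, psi x = l x
  integral : ∀ v : Fin d → ℤ, latticePt v ∈ S.support → ∃ k : ℤ, psi (latticePt v) = k

namespace ToricLineBundle

variable {d : ℕ} {S : ToricFan d}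

/-- The `n`-th tensor power `O(ψ)^{⊗ n} = O(n ψ)`. -/
def pow (L : ToricLineBundle S) (n : ℕ) : ToricLineBundle S where
  psi := fun x => n * L.psi x
  linearOn := by
    intro σ hσ
    obtain ⟨l, hl⟩ := L.linearOn σ hσ
    refine ⟨(n : ℝ) • l, fun x hx => ?_⟩
    simp [hl x hx]
  integral := by
    intro v hv
    obtain ⟨k, hk⟩ := L.integral v hv
    exact ⟨n * k, by rw [hk]; push_cast; rfl⟩

/-- The moment polyhedron `{y ∈ M_ℝ | ⟨y, v_ρ⟩ ≤ ψ(v_ρ) for all rays ρ}`. -/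
def momentPolyhedron (L : ToricLineBundle S) : Set (Fin d → ℝ) :=
  {y | ∀ v ∈ S.rays, y ⬝ᵥ latticePt v ≤ L.psi (latticePt v)}

/-- The line bundle is ample: the outer normal fan of its moment polyhedron is `Σ`. -/
def IsAmple (L : ToricLineBundle S) : Prop :=
  outerNormalFan L.momentPolyhedron = (S.cones : Set (PointedCone ℝ (Fin d → ℝ)))

end ToricLineBundle

/-- `X_Σ` is projective: it is complete and carries an ample line bundle. -/
def ToricFan.IsProjective {d : ℕ} (S : ToricFan d) : Prop :=
  S.IsComplete ∧ ∃ L : ToricLineBundle S, L.IsAmple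

/-! ### Bergman fan and apartments -/

section Matroids

variable {α : Type*}

/-- The support of the Bergman fan of a matroid: the `w` such that on each circuit the minimum of
the coordinates of `w` is attained at least twice. -/
def bergman (𝓜 : Matroid α) : Set (α → ℝ) :=
  {w | ∀ C, 𝓜.IsCircuit C → ∃ e ∈ C, ∃ f ∈ C, e ≠ f ∧ ∀ g ∈ C, w e ≤ w g ∧ w f ≤ w g}

/-- The vector `δ_B`. -/
def deltaVec (B : Set α) : α → ℝ := B.indicator 1

/-- The matroid polytope, the convex hull of the `δ_B` for the bases `B`. -/
def matroidPolytope (𝓜 : Matroid α) : Set (α → ℝ) :=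
  convexHull ℝ {x | ∃ B, 𝓜.IsBase B ∧ x = deltaVec B}

/-- The apartment `A_B`: the intersection of the Bergman fan with the maximal cone of the Gröbner
fan (the outer normal fan of the matroid polytope) that belongs to the basis `B`. -/
def apartment [Fintype α] (𝓜 : Matroid α) (B : Set α) : Set (α → ℝ) :=
  bergman 𝓜 ∩ {w | w ∈ normalCone (matroidPolytope 𝓜) (deltaVec B)}

theorem bergman_shift {𝓜 : Matroid α} {w : α → ℝ} (hw : w ∈ bergman 𝓜) (c : ℝ) :
    (fun e => w e + c) ∈ bergman 𝓜 := by
  intro C hC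
  obtain ⟨e, he, f, hf, hne, h⟩ := hw C hC
  exact ⟨e, he, f, hf, hne, fun g hg =>
    ⟨by linarith [(h g hg).1], by linarith [(h g hg).2]⟩⟩

theorem sum_deltaVec [Fintype α] (B : Set α) : ∑ e, deltaVec B e = (B.ncard : ℝ) := by
  classical
  rw [Set.ncard_eq_toFinset_card' B]
  simp [deltaVec, Set.indicator_apply, Set.toFinset]

theorem sum_of_mem_matroidPolytope [Fintype α] {𝓜 : Matroid α} {B : Set α} (hB : 𝓜.IsBase B)
    {y : α → ℝ} (hy : y ∈ matroidPolytope 𝓜) : ∑ e, y e = ∑ e, deltaVec B e := by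
  have hconv : Convex ℝ {y : α → ℝ | ∑ e, y e = ∑ e, deltaVec B e} :=
    convex_hyperplane (𝕜 := ℝ) (f := fun y : α → ℝ => ∑ e, y e)
      ⟨fun x y => by simp [Finset.sum_add_distrib], fun c x => by simp [Finset.mul_sum]⟩ _
  refine convexHull_min ?_ hconv hy
  rintro x ⟨B', hB', rfl⟩
  rw [Set.mem_ofPred_eq, sum_deltaVec, sum_deltaVec, hB'.ncard_eq_ncard_of_isBase hB]

theorem apartment_shift [Fintype α] {𝓜 : Matroid α} {B : Set α} (hB : 𝓜.IsBase B) {w : α → ℝ}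
    (hw : w ∈ apartment 𝓜 B) (c : ℝ) : (fun e => w e + c) ∈ apartment 𝓜 B := by
  refine ⟨bergman_shift hw.1 c, fun y' hy' => ?_⟩
  have h := hw.2 y' hy'
  have key : ∀ z : α → ℝ, z ⬝ᵥ (fun e => w e + c) = z ⬝ᵥ w + (∑ e, z e) * c := by
    intro z
    simp [dotProduct, mul_add, Finset.sum_add_distrib, Finset.sum_mul]
  rw [key, key, sum_of_mem_matroidPolytope hB hy']
  linarith

end Matroids

/-! ### Tropical toric vector bundles -/

/-- A tropical toric vector bundle on `X_Σ` with matroid `𝓜`: an integral piecewise linear map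
`Φ : |Σ| → Berg(𝓜)`, i.e. each cone is mapped to some apartment `A_B` and `Φ` is linear on the
cone when `A_B` is identified with `ℝ^B` by the projection to the coordinates in `B`. The
component `x ↦ Φ x e` is the piecewise linear function `𝔳(e)`. -/
structure TropicalToricVectorBundle {d : ℕ} (S : ToricFan d) {α : Type*} [Fintype α]
    (𝓜 : Matroid α) where
  Phi : (Fin d → ℝ) → α → ℝ
  mem_bergman : ∀ x ∈ S.support, Phi x ∈ bergman 𝓜
  apartment_linear : ∀ σ ∈ S.cones, ∃ B, 𝓜.IsBase B ∧ (∀ x ∈ σ, Phi x ∈ apartment 𝓜 B) ∧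
    ∀ b ∈ B, ∃ l : (Fin d → ℝ) →ₗ[ℝ] ℝ, ∀ x ∈ σ, Phi x b = l x
  integral : ∀ v : Fin d → ℤ, latticePt v ∈ S.support →
    ∀ e, ∃ k : ℤ, Phi (latticePt v) e = k

namespace TropicalToricVectorBundle

variable {d : ℕ} {S : ToricFan d} {α : Type*} [Fintype α] {𝓜 : Matroid α}

/-- The tensor product `𝔈 ⊗ O(ψ)`: the row `Φ(v_ρ)` of the diagram is shifted by `ψ(v_ρ)`. -/
def tensor (E : TropicalToricVectorBundle S 𝓜) (L : ToricLineBundle S) :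
    TropicalToricVectorBundle S 𝓜 where
  Phi := fun x e => E.Phi x e + L.psi x
  mem_bergman := fun x hx => bergman_shift (E.mem_bergman x hx) _
  apartment_linear := by
    intro σ hσ
    obtain ⟨B, hB, hap, hlin⟩ := E.apartment_linear σ hσ
    obtain ⟨l', hl'⟩ := L.linearOn σ hσ
    refine ⟨B, hB, fun x hx => apartment_shift hB (hap x hx) _, fun b hb => ?_⟩
    obtain ⟨l, hl⟩ := hlin b hb
    exact ⟨l + l', fun x hx => by simp [hl x hx, hl' x hx]⟩
  integral := by
    intro v hv e
    obtain ⟨k, hk⟩ := E.integral v hv e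
    obtain ⟨k', hk'⟩ := L.integral v hv
    exact ⟨k + k', by rw [hk, hk']; push_cast; rfl⟩

/-- The polyhedron `P_{𝔳(e),σ} ⊆ M_ℝ`. -/
def localPolyhedron (E : TropicalToricVectorBundle S 𝓜) (e : α)
    (σ : PointedCone ℝ (Fin d → ℝ)) : Set (Fin d → ℝ) :=
  {y | ∀ v ∈ S.raysOf σ, y ⬝ᵥ latticePt v ≤ E.Phi (latticePt v) e}

/-- The polyhedron `P_{𝔳(e)} ⊆ M_ℝ` of the parliament of polytopes. -/
def polyhedron (E : TropicalToricVectorBundle S 𝓜) (e : α) : Set (Fin d → ℝ) :=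
  {y | ∀ v ∈ S.rays, y ⬝ᵥ latticePt v ≤ E.Phi (latticePt v) e}

/-- The matroid `H^0(U_σ, 𝔈)_u` of sections of weight `u` over the affine chart `U_σ`. -/
def localSections (E : TropicalToricVectorBundle S 𝓜) (σ : PointedCone ℝ (Fin d → ℝ))
    (u : Fin d → ℤ) : Matroid α :=
  𝓜.restrict {e ∈ 𝓜.E | latticePt u ∈ E.localPolyhedron e σ}

/-- The matroid `H^0(X_Σ, 𝔈)_u` of global sections of weight `u`. -/
def globalSections (E : TropicalToricVectorBundle S 𝓜) (u : Fin d → ℤ) : Matroid α :=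
  𝓜.restrict {e ∈ 𝓜.E | latticePt u ∈ E.polyhedron e}

/-- `h^0(X_Σ, 𝔈)_u`, the rank of the (finite) matroid `H^0(X_Σ, 𝔈)_u`. -/
def h0Weight (E : TropicalToricVectorBundle S 𝓜) (u : Fin d → ℤ) : ℕ :=
  (E.globalSections u).eRank.toNat

/-- `h^0(X_Σ, 𝔈)`, the rank of `H^0(X_Σ, 𝔈) = ⨁_u H^0(X_Σ, 𝔈)_u`. -/
def h0 (E : TropicalToricVectorBundle S 𝓜) : ℕ := ∑ᶠ u : Fin d → ℤ, E.h0Weight u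

/-- The equivariant Euler characteristic `χ(X_Σ, 𝔈)_u`. -/
def eulerChar (E : TropicalToricVectorBundle S 𝓜) (u : Fin d → ℤ) : ℤ :=
  ∑ σ ∈ S.cones, (-1) ^ coneCodim σ * ((E.localSections σ u).eRank.toNat : ℤ)

end TropicalToricVectorBundle

end

/-! The proof localizes $\chi_u$ at the full-dimensional cones and compares the result with global
sections through a convexity argument.

Localization: fix a generic direction `ξ`. Displacing a relative interior point of a cone $\gamma$
along `ξ` leads into exactly one full-dimensional cone $\sigma\supseteq\gamma$, so the sum over
$\Sigma$ splits into sums over certain faces of each $\sigma$ (`IsFrame.sum_cones`). Over all faces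
of $\sigma$ the ranks count elements of a single basis `A σ` (`rank_localSections_cell`), and the
alternating sum factors over the edges. Thus $\chi_u$ is a signed count of half-open flipped cones
at $u$ (`eulerChar_eq_sum_maxCones`), and `ξ` may be chosen to suit $u$.

Comparison: let $f(x)=n\psi(x)-\langle u,x\rangle$ (`excess`), a sublinear function, and let $C$
bound the values of $\Phi$ on the rays. If $f(x)<-C\|x\|$ for some generic $x$, both sides vanish,
$\chi_u$ by localization along $-x$. Otherwise $f\ge -C\|\cdot\|$ everywhere, and for large $n$
strict convexity of $\psi$ forces all rays with $f(v_\rho)\le C$ into one cone $\tau$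
(`exists_maxCone_of_excess_ge`). The conditions at the other rays hold for every $e$, and
localization along $-x$ with $x$ interior to $\tau$ leaves only the contribution of $\tau$, which is
the rank of the global sections (`eulerChar_eq_h0Weight_of_maxCone`).

Polynomiality: multiplying $\sum_u h^0_u t^u$ by $\prod(1-t^{-m})$ over all edge directions $m$
turns each flipped cone into one monomial with exponent affine in $n$. Substituting
$t^u=(1+X)^{\langle u,\eta\rangle}$ and comparing one coefficient expresses $h^0$ by binomial
coefficients polynomial in $n$ (`exists_polynomial_h0`). Bounds of order $n^d$ from both sides fix
the degree, and vanishing finite differences spread integrality to all integers. -/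

open Filter Topology

/-! ### Unimodular cones -/

namespace ToricFan

section Cells

variable {d : ℕ}

theorem latticePt_smul (k : ℤ) (v : Fin d → ℤ) : latticePt (k • v) = (k : ℝ) • latticePt v := by
  ext i; simp [latticePt]

theorem latticePt_sum {ι : Type*} (s : Finset ι) (f : ι → Fin d → ℤ) :
    latticePt (∑ i ∈ s, f i) = ∑ i ∈ s, latticePt (f i) := by
  ext k; simp [latticePt]

theorem latticePt_injective : Function.Injective (latticePt (d := d)) := by
  intro v w h
  ext i
  have := congrFun h i
  simpa [latticePt] using this

theorem latticePt_dotProduct (u v : Fin d → ℤ) :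
    latticePt u ⬝ᵥ latticePt v = ((u ⬝ᵥ v : ℤ) : ℝ) := by
  simp [latticePt, dotProduct]

/-- The real coordinate functions of a lattice basis. -/
noncomputable def coord (b : Module.Basis (Fin d) ℤ (Fin d → ℤ)) (i : Fin d) : (Fin d → ℝ) →ₗ[ℝ] ℝ where
  toFun x := ∑ k, x k * (b.repr (Pi.single k 1) i : ℝ)
  map_add' x y := by simp [add_mul, Finset.sum_add_distrib]
  map_smul' c x := by simp [Finset.mul_sum, mul_assoc]

variable (b : Module.Basis (Fin d) ℤ (Fin d → ℤ))

theorem coord_apply (i : Fin d) (x : Fin d → ℝ) :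
    coord b i x = ∑ k, x k * (b.repr (Pi.single k 1) i : ℝ) := rfl

theorem coord_latticePt (i : Fin d) (v : Fin d → ℤ) : coord b i (latticePt v) = b.repr v i := by
  have h : v = ∑ k, v k • (Pi.single k 1 : Fin d → ℤ) := by
    ext j; simp [Finset.sum_apply, Pi.single_apply]
  conv_rhs => rw [h, map_sum]
  simp only [Finsupp.coe_finsetSum, Finset.sum_apply, map_smul, Finsupp.smul_apply, smul_eq_mul]
  simp [coord_apply, latticePt]

theorem coord_basis (i j : Fin d) : coord b i (latticePt (b j)) = if j = i then 1 else 0 := by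
  rw [coord_latticePt, b.repr_self, Finsupp.single_apply]
  split_ifs <;> simp

theorem coord_basis_self (i : Fin d) : coord b i (latticePt (b i)) = 1 := by simp [coord_basis]

theorem coord_basis_of_ne {i j : Fin d} (h : j ≠ i) : coord b i (latticePt (b j)) = 0 := by
  simp [coord_basis, h]

theorem sum_coord_smul (x : Fin d → ℝ) : ∑ i, coord b i x • latticePt (b i) = x := by
  have key : ∀ k : Fin d, ∑ i, coord b i (Pi.single k 1) • latticePt (b i) = Pi.single k 1 := by
    intro k
    have h1 : (Pi.single k 1 : Fin d → ℝ) = latticePt (Pi.single k 1) := by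
      ext j; by_cases h : j = k
      · subst h; simp [latticePt]
      · simp [latticePt, h]
    rw [h1]
    simp_rw [coord_latticePt]
    conv_rhs => rw [← b.sum_repr (Pi.single k 1)]
    rw [latticePt_sum]
    exact Finset.sum_congr rfl fun i _ => (latticePt_smul _ _).symm
  have hx : x = ∑ k, x k • (Pi.single k 1 : Fin d → ℝ) := by
    ext j; simp [Finset.sum_apply, Pi.single_apply]
  conv_rhs => rw [hx]
  conv_lhs => rw [hx]
  simp_rw [map_sum, map_smul, Finset.sum_smul]
  rw [Finset.sum_comm]
  refine Finset.sum_congr rfl fun k _ => ?_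
  conv_rhs => rw [← key k]
  rw [Finset.smul_sum]
  exact Finset.sum_congr rfl fun i _ => by rw [smul_eq_mul, mul_smul]

theorem linear_apply_eq_sum_coord (l : (Fin d → ℝ) →ₗ[ℝ] ℝ) (x : Fin d → ℝ) :
    l x = ∑ i, coord b i x * l (latticePt (b i)) := by
  conv_lhs => rw [← sum_coord_smul b x]
  simp

theorem ext_coord {x y : Fin d → ℝ} (h : ∀ i, coord b i x = coord b i y) : x = y := by
  rw [← sum_coord_smul b x, ← sum_coord_smul b y]
  simp [h]

/-- The cone generated by part of a lattice basis. -/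
def cell (I : Finset (Fin d)) : PointedCone ℝ (Fin d → ℝ) :=
  PointedCone.hull ℝ ((fun i => latticePt (b i)) '' (I : Set (Fin d)))

variable {b}

theorem mem_cell {I : Finset (Fin d)} {x : Fin d → ℝ} :
    x ∈ cell b I ↔ (∀ i, 0 ≤ coord b i x) ∧ ∀ i, i ∉ I → coord b i x = 0 := by
  constructor
  · intro hx
    induction hx using Submodule.span_induction with
    | mem x h =>
      obtain ⟨j, hj, rfl⟩ := h
      refine ⟨fun i => ?_, fun i hi => ?_⟩
      · simp only [coord_basis]; split_ifs <;> norm_num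
      · exact coord_basis_of_ne b (by rintro rfl; exact hi hj)
    | zero => simp
    | add x y _ _ hx hy =>
      refine ⟨fun i => ?_, fun i hi => ?_⟩
      · rw [map_add]; exact add_nonneg (hx.1 i) (hy.1 i)
      · rw [map_add, hx.2 i hi, hy.2 i hi, add_zero]
    | smul a x _ hx =>
      have h : ∀ i, coord b i (a • x) = (a : ℝ) * coord b i x := fun i =>
        (coord b i).map_smul (a : ℝ) x
      refine ⟨fun i => ?_, fun i hi => ?_⟩
      · rw [h]; exact mul_nonneg a.2 (hx.1 i)
      · rw [h, hx.2 i hi, mul_zero]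
  · rintro ⟨h0, h1⟩
    rw [← sum_coord_smul b x]
    refine Submodule.sum_mem _ fun i _ => ?_
    by_cases hi : i ∈ I
    · exact Submodule.smul_mem _ (⟨coord b i x, h0 i⟩ : {c : ℝ // 0 ≤ c})
        (Submodule.subset_span ⟨i, hi, rfl⟩)
    · rw [h1 i hi, zero_smul]; exact Submodule.zero_mem _

theorem mem_cell_univ {x : Fin d → ℝ} : x ∈ cell b Finset.univ ↔ ∀ i, 0 ≤ coord b i x := by
  simp [mem_cell]

theorem basis_mem_cell {I : Finset (Fin d)} {i : Fin d} : latticePt (b i) ∈ cell b I ↔ i ∈ I := by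
  constructor
  · intro h
    by_contra hi
    have := (mem_cell.1 h).2 i hi
    simp [coord_basis_self] at this
  · intro h; exact Submodule.subset_span ⟨i, h, rfl⟩

theorem cell_injective : Function.Injective (cell b) := by
  intro I J h
  ext i
  rw [← basis_mem_cell (b := b), ← basis_mem_cell (b := b), h]

theorem cell_mono {I J : Finset (Fin d)} (h : I ⊆ J) : cell b I ≤ cell b J :=
  Submodule.span_mono (Set.image_mono (by exact_mod_cast h))

theorem smul_mem_cone {C : PointedCone ℝ (Fin d → ℝ)} {c : ℝ} (hc : 0 ≤ c) {x : Fin d → ℝ}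
    (hx : x ∈ C) : c • x ∈ C :=
  Submodule.smul_mem C (⟨c, hc⟩ : {c : ℝ // 0 ≤ c}) hx

theorem isFaceOf_cell (I J : Finset (Fin d)) (h : I ⊆ J) : (cell b I).IsFaceOf (cell b J) := by
  refine ⟨cell_mono h, fun {x y a} hx hy ha hxy => ?_⟩
  rw [mem_cell] at hx hy hxy ⊢
  refine ⟨hx.1, fun i hi => ?_⟩
  have := hxy.2 i hi
  rw [map_add, map_smul, smul_eq_mul] at this
  have h1 := hx.1 i
  have h2 := hy.1 i
  have h3 : 0 ≤ a * coord b i x := mul_nonneg ha.le h1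
  have h4 : a * coord b i x = 0 := by linarith
  rcases mul_eq_zero.1 h4 with h5 | h5
  · exact absurd h5 ha.ne'
  · exact h5

theorem eq_cell_of_isFaceOf {J : Finset (Fin d)} {F : PointedCone ℝ (Fin d → ℝ)}
    (hF : F.IsFaceOf (cell b J)) : ∃ I ⊆ J, F = cell b I := by
  classical
  refine ⟨J.filter fun i => latticePt (b i) ∈ F, Finset.filter_subset _ _, le_antisymm ?_ ?_⟩
  · intro x hx
    have hxJ := mem_cell.1 (hF.le hx)
    refine mem_cell.2 ⟨hxJ.1, fun i hi => ?_⟩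
    by_contra hne
    have hiJ : i ∈ J := by
      by_contra h; exact hne (hxJ.2 i h)
    refine hi (Finset.mem_filter.2 ⟨hiJ, ?_⟩)
    have hpos : 0 < coord b i x := lt_of_le_of_ne (hxJ.1 i) (Ne.symm hne)
    -- Split off the `i`-th summand of `x`: both parts lie in the cone, so the face property puts
    -- the generator into `F`.
    refine hF.mem_of_smul_add_mem (y := x - coord b i x • latticePt (b i)) (a := coord b i x)
      (basis_mem_cell.2 hiJ) ?_ hpos (by simpa using hx)
    refine mem_cell.2 ⟨fun j => ?_, fun j hj => ?_⟩
    · rw [map_sub, map_smul, coord_basis]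
      split_ifs with h
      · subst h; simp
      · simpa using hxJ.1 j
    · rw [map_sub, map_smul, coord_basis_of_ne b (by rintro rfl; exact hj hiJ), hxJ.2 j hj]
      simp
  · refine Submodule.span_le.2 ?_
    rintro _ ⟨i, hi, rfl⟩
    exact (Finset.mem_filter.1 hi).2

theorem linearIndependent_latticePt : LinearIndependent ℝ fun i => latticePt (b i) := by
  rw [Fintype.linearIndependent_iff]
  intro g hg j
  have := congrArg (coord b j) hg
  simpa [coord_basis] using this

theorem span_cell (I : Finset (Fin d)) :
    Submodule.span ℝ (cell b I : Set (Fin d → ℝ)) =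
      Submodule.span ℝ ((fun i => latticePt (b i)) '' (I : Set (Fin d))) := by
  refine le_antisymm (Submodule.span_le.2 ?_) (Submodule.span_mono Submodule.subset_span)
  intro x hx
  exact PointedCone.hull_le_span ℝ _ hx

theorem mem_span_cell {I : Finset (Fin d)} {x : Fin d → ℝ} (h : ∀ i, i ∉ I → coord b i x = 0) :
    x ∈ Submodule.span ℝ (cell b I : Set (Fin d → ℝ)) := by
  rw [← sum_coord_smul b x]
  refine Submodule.sum_mem _ fun i _ => ?_
  by_cases hi : i ∈ I
  · exact Submodule.smul_mem _ _ (Submodule.subset_span (basis_mem_cell.2 hi))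
  · rw [h i hi, zero_smul]; exact Submodule.zero_mem _

theorem coneCodim_cell (I : Finset (Fin d)) : coneCodim (cell b I) = d - I.card := by
  classical
  rw [coneCodim, span_cell]
  congr 1
  have h := finrank_span_eq_card (R := ℝ) (b := fun i : I => latticePt (b i))
    (linearIndependent_latticePt.comp _ Subtype.val_injective)
  rw [Fintype.card_coe] at h
  rw [← h, Set.image_eq_range]
  rfl

theorem coneCodim_cell_eq_zero {I : Finset (Fin d)} :
    coneCodim (cell b I) = 0 ↔ I = Finset.univ := by
  rw [coneCodim_cell]
  constructor
  · intro h
    rw [← Finset.card_eq_iff_eq_univ, Fintype.card_fin]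
    have : I.card ≤ d := by simpa using I.card_le_univ
    omega
  · rintro rfl; simp

theorem isPrimitiveVec_basis (i : Fin d) : IsPrimitiveVec (b i) := by
  intro k w h
  have := congrArg (fun v => b.repr v i) h
  simp only [b.repr_self, map_smul, Finsupp.smul_apply, Finsupp.single_eq_same,
    smul_eq_mul] at this
  exact IsUnit.of_mul_eq_one _ this.symm

theorem latticePt_ne_zero_of_isPrimitiveVec {v : Fin d → ℤ} (hv : IsPrimitiveVec v) :
    latticePt v ≠ 0 := by
  intro h
  have h0 : v = 0 := latticePt_injective (h.trans (by ext; simp [latticePt]))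
  have h2 := hv 2 0 (by simp [h0])
  rw [Int.isUnit_iff] at h2
  omega

/-- The primitive generator of a ray that is generated by part of a lattice basis belongs to
that basis. -/
theorem eq_basis_of_hull_eq_cell {v : Fin d → ℤ} (hv : IsPrimitiveVec v) {I : Finset (Fin d)}
    (h : PointedCone.hull ℝ {latticePt v} = cell b I) : ∃ i ∈ I, v = b i := by
  have hmem : latticePt v ∈ cell b I := h ▸ Submodule.subset_span rfl
  obtain ⟨j, hj⟩ : ∃ j, coord b j (latticePt v) ≠ 0 := by
    by_contra! hc
    exact latticePt_ne_zero_of_isPrimitiveVec hv (ext_coord b fun i => by rw [hc i, map_zero])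
  have hjI : j ∈ I := by
    by_contra hcon
    exact hj ((mem_cell.1 hmem).2 j hcon)
  have hbj : latticePt (b j) ∈ PointedCone.hull ℝ {latticePt v} := h ▸ basis_mem_cell.2 hjI
  obtain ⟨c, hc⟩ := Submodule.mem_span_singleton.1 hbj
  have hc' : (c : ℝ) • latticePt v = latticePt (b j) := hc
  have hcj : (c : ℝ) * coord b j (latticePt v) = 1 := by
    have := congrArg (coord b j) hc'
    rwa [map_smul, coord_basis_self] at this
  have hv' : v = (b.repr v j) • b j := by
    apply latticePt_injective
    rw [latticePt_smul, ← coord_latticePt, ← hc', smul_smul, mul_comm, hcj, one_smul]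
  have hu := hv _ _ hv'
  rcases Int.isUnit_iff.1 hu with h1 | h1
  · exact ⟨j, hjI, by rw [h1, one_smul] at hv'; exact hv'⟩
  · exfalso
    rw [coord_latticePt, h1] at hcj
    have := c.2
    push_cast at hcj
    linarith

end Cells

end ToricFan

/-! ### Generic directions and the decomposition of a complete smooth fan -/

namespace ToricFan

variable {d : ℕ} {S : ToricFan d}

theorem IsSmooth.exists_eq_cell (hs : S.IsSmooth) {σ : PointedCone ℝ (Fin d → ℝ)}
    (hσ : σ ∈ S.cones) : ∃ b I, σ = cell b I := by
  classical
  obtain ⟨b, s, h⟩ := hs σ hσ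
  exact ⟨b, s.toFinset, by simpa [cell] using h⟩

variable (S) in
/-- The full-dimensional cones of a fan. -/
noncomputable def maxCones : Finset (PointedCone ℝ (Fin d → ℝ)) :=
  open Classical in S.cones.filter fun σ => coneCodim σ = 0

theorem mem_maxCones {σ : PointedCone ℝ (Fin d → ℝ)} :
    σ ∈ S.maxCones ↔ σ ∈ S.cones ∧ coneCodim σ = 0 := by
  simp [maxCones]

theorem mem_cones_of_mem_maxCones {σ : PointedCone ℝ (Fin d → ℝ)} (h : σ ∈ S.maxCones) :
    σ ∈ S.cones := (mem_maxCones.1 h).1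

variable (S) in
/-- A choice of a lattice basis that generates `σ`, for each full-dimensional cone `σ`. -/
def IsFrame (β : PointedCone ℝ (Fin d → ℝ) → Module.Basis (Fin d) ℤ (Fin d → ℤ)) : Prop :=
  ∀ σ ∈ S.maxCones, σ = cell (β σ) Finset.univ

theorem IsSmooth.exists_isFrame (hs : S.IsSmooth) : ∃ β, S.IsFrame β := by
  have h : ∀ σ : PointedCone ℝ (Fin d → ℝ), ∃ b : Module.Basis (Fin d) ℤ (Fin d → ℤ),
      σ ∈ S.maxCones → σ = cell b Finset.univ := by
    intro σ
    by_cases hσ : σ ∈ S.maxCones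
    · obtain ⟨b, I, rfl⟩ := hs.exists_eq_cell (mem_maxCones.1 hσ).1
      rw [coneCodim_cell_eq_zero.1 (mem_maxCones.1 hσ).2]
      exact ⟨b, fun _ => rfl⟩
    · exact ⟨Pi.basisFun ℤ (Fin d), fun h => absurd h hσ⟩
  choose β hβ using h
  exact ⟨β, hβ⟩

variable (S) in
/-- A vector is generic if it avoids the spans of the cones that are not full-dimensional. -/
def Generic (x : Fin d → ℝ) : Prop :=
  ∀ σ ∈ S.cones, coneCodim σ ≠ 0 → x ∉ Submodule.span ℝ (σ : Set (Fin d → ℝ))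

theorem Generic.neg {x : Fin d → ℝ} (hx : S.Generic x) : S.Generic (-x) :=
  fun σ hσ h hc => hx σ hσ h (by simpa using hc)

theorem exists_generic : ∃ x, S.Generic x := by
  classical
  let P : Finset (Submodule ℝ (Fin d → ℝ)) :=
    (S.cones.filter fun σ => coneCodim σ ≠ 0).image
      fun σ : PointedCone ℝ (Fin d → ℝ) => Submodule.span ℝ (σ : Set (Fin d → ℝ))
  have hP : ⊤ ∉ P := by
    intro h
    obtain ⟨σ, hσ, h⟩ := Finset.mem_image.1 h
    refine (Finset.mem_filter.1 hσ).2 ?_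
    rw [coneCodim, h, finrank_top, Module.finrank_fin_fun, Nat.sub_self]
  have h := Subspace.biUnion_ne_univ_of_top_notMem hP
  obtain ⟨x, hx⟩ := (Set.ne_univ_iff_exists_notMem _).1 h
  refine ⟨x, fun σ hσ h0 hc => hx ?_⟩
  simp only [Set.mem_iUnion]
  exact ⟨_, Finset.mem_image_of_mem _ (Finset.mem_filter.2 ⟨hσ, h0⟩), hc⟩

/-- The line `x + t • ζ` meets each proper span at most once, since two meeting points would put `ζ`
into the span. Small positive `t` avoid these finitely many values. -/
theorem Generic.eventually_add_smul {ζ : Fin d → ℝ} (hζ : S.Generic ζ) (x : Fin d → ℝ) :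
    ∀ᶠ t : ℝ in 𝓝[>] 0, S.Generic (x + t • ζ) := by
  have h : ∀ σ ∈ S.cones, ∀ᶠ t : ℝ in 𝓝[>] 0, coneCodim σ ≠ 0 →
      x + t • ζ ∉ Submodule.span ℝ (σ : Set (Fin d → ℝ)) := by
    intro σ hσ
    by_cases hc : ∃ t₀ : ℝ, 0 < t₀ ∧ x + t₀ • ζ ∈ Submodule.span ℝ (σ : Set (Fin d → ℝ))
    · obtain ⟨t₀, ht₀, h₀⟩ := hc
      filter_upwards [Ioo_mem_nhdsGT ht₀] with t ht hσ0 h1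
      refine hζ σ hσ hσ0 ?_
      have h2 := Submodule.sub_mem _ h₀ h1
      rw [add_sub_add_left_eq_sub, ← sub_smul] at h2
      exact (Submodule.smul_mem_iff _ (sub_pos.2 ht.2).ne').1 h2
    · filter_upwards [self_mem_nhdsWithin] with t ht _ h1
      exact hc ⟨t, ht, h1⟩
  exact ((eventually_all_finset S.cones).2 h).mono fun t ht σ hσ => ht σ hσ

variable {β : PointedCone ℝ (Fin d → ℝ) → Module.Basis (Fin d) ℤ (Fin d → ℤ)}

section Frame

variable (hβ : S.IsFrame β)
include hβ

theorem IsFrame.mem_iff {σ : PointedCone ℝ (Fin d → ℝ)} (hσ : σ ∈ S.maxCones) {x : Fin d → ℝ} :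
    x ∈ σ ↔ ∀ i, 0 ≤ coord (β σ) i x := by
  conv_lhs => rw [hβ σ hσ]
  exact mem_cell_univ

theorem IsFrame.cell_mem {σ : PointedCone ℝ (Fin d → ℝ)} (hσ : σ ∈ S.maxCones)
    (I : Finset (Fin d)) : cell (β σ) I ∈ S.cones := by
  refine S.face_mem σ (mem_maxCones.1 hσ).1 _ ?_
  have := isFaceOf_cell (b := β σ) I Finset.univ (Finset.subset_univ I)
  rwa [← hβ σ hσ] at this

theorem IsFrame.basis_mem {σ : PointedCone ℝ (Fin d → ℝ)} (hσ : σ ∈ S.maxCones) (i : Fin d) :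
    latticePt (β σ i) ∈ σ := by
  rw [hβ.mem_iff hσ]
  intro j
  rw [coord_basis]
  split_ifs <;> norm_num

theorem IsFrame.eq_cell_of_le {σ γ : PointedCone ℝ (Fin d → ℝ)} (hσ : σ ∈ S.maxCones)
    (hγ : γ ∈ S.cones) (h : γ ≤ σ) : ∃ I, γ = cell (β σ) I := by
  have h1 := (S.inter_face γ hγ σ (mem_maxCones.1 hσ).1).2
  rw [inf_eq_left.2 h, hβ σ hσ] at h1
  obtain ⟨I, -, hI⟩ := eq_cell_of_isFaceOf h1
  exact ⟨I, hI⟩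

theorem IsFrame.coord_ne_zero {σ : PointedCone ℝ (Fin d → ℝ)} (hσ : σ ∈ S.maxCones)
    {x : Fin d → ℝ} (hx : S.Generic x) (i : Fin d) : coord (β σ) i x ≠ 0 := by
  classical
  intro h0
  refine hx _ (hβ.cell_mem hσ (Finset.univ.erase i)) ?_ (mem_span_cell ?_)
  · rw [Ne, coneCodim_cell_eq_zero]
    intro h
    have := h ▸ Finset.mem_univ i
    simp at this
  · intro j hj
    have : j = i := by simpa using hj
    rw [this, h0]

/-- Different full-dimensional cones have disjoint interiors. -/
theorem IsFrame.eq_of_interior {σ σ' : PointedCone ℝ (Fin d → ℝ)} (hσ : σ ∈ S.maxCones)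
    (hσ' : σ' ∈ S.maxCones) {q : Fin d → ℝ} (hq : ∀ i, 0 < coord (β σ) i q) (hq' : q ∈ σ') :
    σ = σ' := by
  have hqσ : q ∈ σ := (hβ.mem_iff hσ).2 fun i => (hq i).le
  have h1 := (S.inter_face σ (mem_maxCones.1 hσ).1 σ' (mem_maxCones.1 hσ').1).1
  -- `q` is a combination of all generators with positive coefficients, so a face of `σ` that
  -- contains `q` contains each generator.
  have hbasis : ∀ i, latticePt (β σ i) ∈ σ ⊓ σ' := fun i =>
    h1.mem_of_sum_smul_mem (fun i => hβ.basis_mem hσ i) (fun i => (hq i).le)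
      (by rw [sum_coord_smul]; exact ⟨hqσ, hq'⟩) i (hq i)
  have hle : σ ≤ σ' := by
    intro x hx
    rw [← sum_coord_smul (β σ) x]
    exact Submodule.sum_mem _ fun i _ =>
      smul_mem_cone ((hβ.mem_iff hσ).1 hx i) (hbasis i).2
  obtain ⟨I, hI⟩ := hβ.eq_cell_of_le hσ' (mem_maxCones.1 hσ).1 hle
  have h0 := (mem_maxCones.1 hσ).2
  rw [hI, coneCodim_cell_eq_zero] at h0
  rw [hI, h0, ← hβ σ' hσ']

end Frame

theorem IsComplete.exists_maxCone_of_generic (hc : S.IsComplete) {x : Fin d → ℝ}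
    (hx : S.Generic x) : ∃ σ ∈ S.maxCones, x ∈ σ := by
  obtain ⟨σ, hσ, h⟩ := hc x
  refine ⟨σ, mem_maxCones.2 ⟨hσ, ?_⟩, h⟩
  by_contra h0
  exact hx σ hσ h0 (Submodule.subset_span h)

/-- Displacing a point slightly in a generic direction moves it into a full-dimensional cone that
contains the point. -/
theorem IsFrame.exists_displacement (hβ : S.IsFrame β) (hc : S.IsComplete) {ξ : Fin d → ℝ}
    (hξ : S.Generic ξ) (p : Fin d → ℝ) :
    ∃ σ ∈ S.maxCones, p ∈ σ ∧ ∀ i, coord (β σ) i p = 0 → 0 < coord (β σ) i ξ := by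
  -- There are finitely many cones, so one of them contains `p + t • ξ` for arbitrarily small `t >
  -- 0`. Being closed, it contains `p`.
  obtain ⟨σ, hσ, hfreq⟩ : ∃ σ ∈ S.maxCones, ∃ᶠ t : ℝ in 𝓝[>] 0, p + t • ξ ∈ σ := by
    by_contra! hcon
    have h1 : ∀ᶠ t : ℝ in 𝓝[>] 0, ∀ σ ∈ S.maxCones, p + t • ξ ∉ σ :=
      (eventually_all_finset S.maxCones).2 fun σ hσ => by simpa using hcon σ hσ
    obtain ⟨t, ht1, ht2⟩ := (h1.and (hξ.eventually_add_smul p)).exists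
    obtain ⟨σ, hσ, h⟩ := hc.exists_maxCone_of_generic ht2
    exact ht1 σ hσ h
  refine ⟨σ, hσ, (hβ.mem_iff hσ).2 fun i => ?_, fun i hi => ?_⟩
  · by_contra! hneg
    have hcont : Tendsto (fun t : ℝ => coord (β σ) i p + t * coord (β σ) i ξ) (𝓝[>] 0)
        (𝓝 (coord (β σ) i p)) := by
      have : Continuous fun t : ℝ => coord (β σ) i p + t * coord (β σ) i ξ := by fun_prop
      have h := this.tendsto 0
      simp only [zero_mul, add_zero] at h
      exact h.mono_left nhdsWithin_le_nhds
    obtain ⟨t, h1, h2⟩ := (hfreq.and_eventually (hcont.eventually_lt_const hneg)).exists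
    have := (hβ.mem_iff hσ).1 h1 i
    rw [map_add, map_smul, smul_eq_mul] at this
    linarith
  · obtain ⟨t, h1, h2⟩ := (hfreq.and_eventually self_mem_nhdsWithin).exists
    have h3 := (hβ.mem_iff hσ).1 h1 i
    rw [map_add, map_smul, smul_eq_mul, hi, zero_add] at h3
    have h4 : 0 ≤ coord (β σ) i ξ := nonneg_of_mul_nonneg_right h3 h2
    exact lt_of_le_of_ne h4 (hβ.coord_ne_zero hσ hξ i).symm

theorem IsFrame.exists_mem_maxCone (hβ : S.IsFrame β) (hc : S.IsComplete) (p : Fin d → ℝ) :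
    ∃ σ ∈ S.maxCones, p ∈ σ := by
  obtain ⟨ξ, hξ⟩ := S.exists_generic
  obtain ⟨σ, hσ, h, -⟩ := hβ.exists_displacement hc hξ p
  exact ⟨σ, hσ, h⟩

/-- Each cone of a complete smooth fan is a face of exactly one full-dimensional cone that a
generic direction points into. -/
theorem IsFrame.exists_assignment (hβ : S.IsFrame β) (hs : S.IsSmooth) (hc : S.IsComplete)
    {ξ : Fin d → ℝ} (hξ : S.Generic ξ) {γ : PointedCone ℝ (Fin d → ℝ)} (hγ : γ ∈ S.cones) :
    ∃ σ ∈ S.maxCones, ∃ I, γ = cell (β σ) I ∧ ∀ i, i ∉ I → 0 < coord (β σ) i ξ := by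
  obtain ⟨b, J, rfl⟩ := hs.exists_eq_cell hγ
  -- The sum of the generators is a relative interior point of the cone, so a cone of the fan that
  -- contains it contains the whole cone.
  obtain ⟨σ, hσ, hp, hpos⟩ := hβ.exists_displacement hc hξ (∑ j ∈ J, latticePt (b j))
  have hpγ : ∑ j ∈ J, latticePt (b j) ∈ cell b J :=
    Submodule.sum_mem _ fun j hj => basis_mem_cell.2 hj
  have hface := (S.inter_face _ hγ σ (mem_maxCones.1 hσ).1).1
  have hle : cell b J ≤ σ := by
    refine Submodule.span_le.2 ?_
    rintro _ ⟨j, hj, rfl⟩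
    have := hface.mem_of_sum_smul_mem (f := fun j : J => latticePt (b j)) (c := fun _ => 1)
      (fun j => basis_mem_cell.2 j.2) (fun _ => zero_le_one)
      (by simp only [one_smul, Finset.univ_eq_attach]
          rw [Finset.sum_attach J fun j => latticePt (b j)]
          exact ⟨hpγ, hp⟩) ⟨j, hj⟩ one_pos
    exact this.2
  obtain ⟨I, hI⟩ := hβ.eq_cell_of_le hσ hγ hle
  refine ⟨σ, hσ, I, hI, fun i hi => hpos i ?_⟩
  rw [hI] at hpγ
  exact (mem_cell.1 hpγ).2 i hi

/-- The sum of the two relative interior points of the common face given by the two frames,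
displaced slightly along `ξ`, is interior to both `σ` and `σ'`. -/
theorem IsFrame.assignment_unique (hβ : S.IsFrame β) {ξ : Fin d → ℝ}
    {σ σ' : PointedCone ℝ (Fin d → ℝ)} (hσ : σ ∈ S.maxCones) (hσ' : σ' ∈ S.maxCones)
    {I I' : Finset (Fin d)} (h : cell (β σ) I = cell (β σ') I')
    (hI : ∀ i, i ∉ I → 0 < coord (β σ) i ξ) (hI' : ∀ i, i ∉ I' → 0 < coord (β σ') i ξ) :
    σ = σ' := by
  have key : ∀ (b : Module.Basis (Fin d) ℤ (Fin d → ℤ)) (J : Finset (Fin d)) (y : Fin d → ℝ),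
      (∀ i, i ∉ J → 0 < coord b i ξ) → y ∈ cell b J →
      ∀ᶠ t : ℝ in 𝓝[>] 0, ∀ i, 0 < coord b i (∑ j ∈ J, latticePt (b j) + y + t • ξ) := by
    intro b J y hJ hy
    rw [eventually_all]
    intro i
    have hyi := mem_cell.1 hy
    have hsum : coord b i (∑ j ∈ J, latticePt (b j)) = if i ∈ J then 1 else 0 := by
      simp [coord_basis]
    by_cases hi : i ∈ J
    · have hcont : Tendsto (fun t : ℝ => 1 + coord b i y + t * coord b i ξ) (𝓝[>] 0)
          (𝓝 (1 + coord b i y)) := by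
        have : Continuous fun t : ℝ => 1 + coord b i y + t * coord b i ξ := by fun_prop
        have h := this.tendsto 0
        simp only [zero_mul, add_zero] at h
        exact h.mono_left nhdsWithin_le_nhds
      have h0 : 0 < 1 + coord b i y := by linarith [hyi.1 i]
      filter_upwards [hcont.eventually_const_lt h0] with t ht
      rwa [map_add, map_add, hsum, if_pos hi, map_smul, smul_eq_mul]
    · filter_upwards [self_mem_nhdsWithin] with t ht
      rw [map_add, map_add, hsum, if_neg hi, hyi.2 i hi, map_smul, smul_eq_mul, add_zero, zero_add]
      exact mul_pos ht (hJ i hi)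
  have hp : ∑ j ∈ I, latticePt (β σ j) ∈ cell (β σ) I :=
    Submodule.sum_mem _ fun j hj => basis_mem_cell.2 hj
  have hp' : ∑ j ∈ I', latticePt (β σ' j) ∈ cell (β σ') I' :=
    Submodule.sum_mem _ fun j hj => basis_mem_cell.2 hj
  obtain ⟨t, h1, h2⟩ := ((key _ _ _ hI (h ▸ hp')).and (key _ _ _ hI' (h ▸ hp))).exists
  refine hβ.eq_of_interior hσ hσ' h1 ((hβ.mem_iff hσ').2 fun i => ?_)
  rw [add_comm (∑ j ∈ I, _)]
  exact (h2 i).le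

/-- Summation over all cones of a complete smooth fan, organized by the full-dimensional cone that
a generic direction assigns to each cone. -/
theorem IsFrame.sum_cones (hβ : S.IsFrame β) (hs : S.IsSmooth) (hc : S.IsComplete)
    {ξ : Fin d → ℝ} (hξ : S.Generic ξ) (f : PointedCone ℝ (Fin d → ℝ) → ℤ) :
    ∑ γ ∈ S.cones, f γ = ∑ σ ∈ S.maxCones,
      ∑ I : Finset (Fin d) with ∀ i, i ∉ I → 0 < coord (β σ) i ξ, f (cell (β σ) I) := by
  classical
  rw [Finset.sum_sigma']
  symm
  refine Finset.sum_bij (fun p _ => cell (β p.1) p.2) ?_ ?_ ?_ ?_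
  · rintro ⟨σ, I⟩ h
    simp only [Finset.mem_sigma] at h
    exact hβ.cell_mem h.1 I
  · rintro ⟨σ, I⟩ h ⟨σ', I'⟩ h' heq
    simp only [Finset.mem_sigma, Finset.mem_filter, Finset.mem_univ, true_and] at h h'
    simp only at heq
    obtain rfl := hβ.assignment_unique h.1 h'.1 heq h.2 h'.2
    rw [cell_injective heq]
  · intro γ hγ
    obtain ⟨σ, hσ, I, hI, hpos⟩ := hβ.exists_assignment hs hc hξ hγ
    exact ⟨⟨σ, I⟩, by simpa [hσ] using hpos, hI.symm⟩
  · intros; rfl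

/-- The `i`-th factor is $[P_i]-[\mathrm{pos}_i]$. In the expansion of the product, `I` records the
factors from which $[P_i]$ is taken. -/
theorem sum_sign_filter_eq_prod (pos P : Fin d → Prop) [DecidablePred pos] [DecidablePred P] :
    ∑ I : Finset (Fin d) with ∀ i, i ∉ I → pos i,
      (-1 : ℤ) ^ (d - I.card) * (if ∀ i ∈ I, P i then 1 else 0) =
    ∏ i, (if pos i then (if P i then 0 else -1) else (if P i then 1 else 0)) := by
  classical
  have h : ∀ i, (if pos i then (if P i then 0 else -1) else (if P i then 1 else 0) : ℤ) =
      (if P i then 1 else 0) + (if pos i then -1 else 0) := by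
    intro i; split_ifs <;> norm_num
  simp_rw [h]
  rw [Finset.prod_add, Finset.powerset_univ, Finset.sum_filter]
  refine Finset.sum_congr rfl fun I _ => ?_
  rw [Finset.prod_ite_zero, Finset.prod_const_one, Finset.prod_ite_zero, Finset.prod_const,
    Finset.card_sdiff, Finset.inter_univ, Finset.card_univ, Fintype.card_fin]
  simp only [Finset.mem_sdiff, Finset.mem_univ, true_and]
  split_ifs <;> simp

/-! #### Rays -/

theorem IsFrame.basis_mem_rays (hβ : S.IsFrame β) {σ : PointedCone ℝ (Fin d → ℝ)}
    (hσ : σ ∈ S.maxCones) (i : Fin d) : β σ i ∈ S.rays := by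
  refine ⟨isPrimitiveVec_basis i, ?_⟩
  have h := hβ.cell_mem hσ {i}
  simpa [cell] using h

theorem IsFrame.raysOf_cell (hβ : S.IsFrame β) {σ : PointedCone ℝ (Fin d → ℝ)}
    (hσ : σ ∈ S.maxCones) (I : Finset (Fin d)) :
    S.raysOf (cell (β σ) I) = (β σ) '' (I : Set (Fin d)) := by
  ext v
  constructor
  · rintro ⟨⟨hv, hray⟩, hmem⟩
    have hle : PointedCone.hull ℝ {latticePt v} ≤ σ := by
      refine Submodule.span_le.2 ?_
      rintro _ rfl
      exact (hβ.mem_iff hσ).2 (mem_cell.1 hmem).1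
    obtain ⟨J, hJ⟩ := hβ.eq_cell_of_le hσ hray hle
    obtain ⟨i, -, rfl⟩ := eq_basis_of_hull_eq_cell hv hJ
    exact ⟨i, basis_mem_cell.1 hmem, rfl⟩
  · rintro ⟨i, hi, rfl⟩
    exact ⟨hβ.basis_mem_rays hσ i, basis_mem_cell.2 hi⟩

theorem IsFrame.raysOf_maxCone (hβ : S.IsFrame β) {σ : PointedCone ℝ (Fin d → ℝ)}
    (hσ : σ ∈ S.maxCones) : S.raysOf σ = Set.range (β σ) := by
  have := hβ.raysOf_cell hσ Finset.univ
  rw [← hβ σ hσ] at this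
  simpa using this

theorem IsFrame.exists_eq_of_mem_rays (hβ : S.IsFrame β) (hc : S.IsComplete) {v : Fin d → ℤ}
    (hv : v ∈ S.rays) : ∃ σ ∈ S.maxCones, ∃ i, v = β σ i := by
  obtain ⟨σ, hσ, h⟩ := hβ.exists_mem_maxCone hc (latticePt v)
  have : v ∈ S.raysOf σ := ⟨hv, h⟩
  rw [hβ.raysOf_maxCone hσ] at this
  obtain ⟨i, rfl⟩ := this
  exact ⟨σ, hσ, i, rfl⟩

theorem IsFrame.finite_rays (hβ : S.IsFrame β) (hc : S.IsComplete) : S.rays.Finite := by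
  refine (S.maxCones.finite_toSet.biUnion fun σ _ => Set.finite_range (β σ)).subset ?_
  intro v hv
  obtain ⟨σ, hσ, i, rfl⟩ := hβ.exists_eq_of_mem_rays hc hv
  exact Set.mem_biUnion hσ ⟨i, rfl⟩

end ToricFan

/-! ### Bases adapted to weight vectors in an apartment -/

section Matroid

variable {α : Type*} {𝓜 : Matroid α} {B : Set α} {w : α → ℝ}

/-- A set cut out by lower bounds on weight vectors in the normal cone of a basis `B` is spanned
by its elements in `B`. -/
theorem isBasis_inter_of_normalCone (hB : 𝓜.IsBase B) {G : Set α} (hG : G ⊆ 𝓜.E)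
    (hup : ∀ e ∈ G, ∀ f ∈ B, e ∉ B → f ∈ 𝓜.fundCircuit e B → f ∈ G) :
    𝓜.IsBasis (B ∩ G) G := by
  refine (hB.indep.inter_right G).isBasis_of_forall_insert Set.inter_subset_right ?_
  rintro e ⟨heG, heB⟩
  have heB' : e ∉ B := fun h => heB ⟨h, heG⟩
  -- The fundamental circuit of `e` lies in `insert e (B ∩ G)`, which is therefore dependent.
  refine (hB.fundCircuit_isCircuit (hG heG) heB').dep.superset ?_ ?_
  · intro f hf
    rcases Set.mem_insert_iff.1 (𝓜.fundCircuit_subset_insert e B hf) with rfl | hfB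
    · exact Set.mem_insert _ _
    · exact Set.mem_insert_of_mem _ ⟨hfB, hup e heG f hfB heB' hf⟩
  · exact Set.insert_subset (hG heG) (Set.inter_subset_right.trans hG)

variable [Fintype α]

theorem deltaVec_dotProduct [DecidablePred (· ∈ B)] (w : α → ℝ) :
    deltaVec B ⬝ᵥ w = ∑ e, if e ∈ B then w e else 0 := by
  simp only [dotProduct, deltaVec, Set.indicator_apply, Pi.one_apply, ite_mul, one_mul, zero_mul]

/-- Exchanging `f` for `e` yields a basis, whose weight is at most that of `B` because `w` is in the
normal cone at `B`. -/
theorem le_of_mem_fundCircuit (hB : 𝓜.IsBase B)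
    (hw : w ∈ normalCone (matroidPolytope 𝓜) (deltaVec B)) {e f : α} (he : e ∈ 𝓜.E) (heB : e ∉ B)
    (hf : f ∈ 𝓜.fundCircuit e B) (hfe : f ≠ e) : w e ≤ w f := by
  classical
  have hfB : f ∈ B := (Set.mem_insert_iff.1 (𝓜.fundCircuit_subset_insert e B hf)).resolve_left hfe
  have hcl : e ∈ 𝓜.closure B := by rwa [hB.closure_eq]
  have hbase := hB.exchange_isBase_of_indep' hfB heB
    ((hB.indep.mem_fundCircuit_iff hcl heB).1 hf)
  have h : deltaVec (insert e B \ {f}) ⬝ᵥ w ≤ deltaVec B ⬝ᵥ w :=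
    hw _ (subset_convexHull ℝ _ ⟨_, hbase, rfl⟩)
  have h2 : ∑ g, ((if g ∈ B then w g else 0) - (if g ∈ insert e B \ {f} then w g else 0)) =
      ∑ g, ((if g = f then w g else 0) - (if g = e then w g else 0)) := by
    refine Finset.sum_congr rfl fun g _ => ?_
    by_cases h1 : g = f
    · subst h1; simp [hfB, hfe]
    · by_cases h2 : g = e
      · subst h2; simp [heB, h1]
      · simp [h1, h2]
  rw [deltaVec_dotProduct, deltaVec_dotProduct] at h
  simp only [Finset.sum_sub_distrib, Finset.sum_ite_eq', Finset.mem_univ, if_true] at h2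
  linarith

end Matroid

/-! ### Localization of the Euler characteristic -/

namespace TropicalToricVectorBundle

open ToricFan

variable {d : ℕ} {S : ToricFan d} {α : Type*} [Fintype α] {𝓜 : Matroid α}
  {β : PointedCone ℝ (Fin d → ℝ) → Module.Basis (Fin d) ℤ (Fin d → ℤ)}

/-- A choice of an apartment for each full-dimensional cone. -/
def IsApartmentChoice (E : TropicalToricVectorBundle S 𝓜)
    (A : PointedCone ℝ (Fin d → ℝ) → Set α) : Prop :=
  ∀ σ ∈ S.maxCones, 𝓜.IsBase (A σ) ∧ ∀ x ∈ σ, E.Phi x ∈ apartment 𝓜 (A σ)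

theorem exists_isApartmentChoice (E : TropicalToricVectorBundle S 𝓜) :
    ∃ A, E.IsApartmentChoice A := by
  have h : ∀ σ : PointedCone ℝ (Fin d → ℝ), ∃ A, σ ∈ S.maxCones →
      𝓜.IsBase A ∧ ∀ x ∈ σ, E.Phi x ∈ apartment 𝓜 A := by
    intro σ
    by_cases hσ : σ ∈ S.maxCones
    · obtain ⟨A, hA, h, -⟩ := E.apartment_linear σ (mem_maxCones.1 hσ).1
      exact ⟨A, fun _ => ⟨hA, h⟩⟩
    · exact ⟨∅, fun h => absurd h hσ⟩
  choose A hA using h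
  exact ⟨A, hA⟩

variable {E : TropicalToricVectorBundle S 𝓜} {A : PointedCone ℝ (Fin d → ℝ) → Set α}

theorem IsApartmentChoice.tensor (hA : E.IsApartmentChoice A) (L : ToricLineBundle S) :
    (E.tensor L).IsApartmentChoice A := fun σ hσ =>
  ⟨(hA σ hσ).1, fun x hx => apartment_shift (hA σ hσ).1 ((hA σ hσ).2 x hx) _⟩

variable (hβ : S.IsFrame β) (hA : E.IsApartmentChoice A) (hground : 𝓜.E = Set.univ)
include hβ hA hground

/-- Each ray imposes a lower bound on the coordinates of a vector in the apartment of `A σ`. An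
element that satisfies it passes it on to the basis elements of its fundamental circuit, whose
weights are no smaller; hence `A σ` meets the set of sections in a basis, for every face of `σ`. -/
theorem rank_localSections_cell {σ : PointedCone ℝ (Fin d → ℝ)} (hσ : σ ∈ S.maxCones)
    (I : Finset (Fin d)) (u : Fin d → ℤ) :
    (E.localSections (cell (β σ) I) u).eRank.toNat = {e ∈ A σ | ∀ i ∈ I,
      latticePt u ⬝ᵥ latticePt (β σ i) ≤ E.Phi (latticePt (β σ i)) e}.ncard := by
  obtain ⟨hbase, hap⟩ := hA σ hσ
  have hset : {e ∈ 𝓜.E | latticePt u ∈ E.localPolyhedron e (cell (β σ) I)} =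
      {e | ∀ i ∈ I, latticePt u ⬝ᵥ latticePt (β σ i) ≤ E.Phi (latticePt (β σ i)) e} := by
    ext e
    simp [hground, localPolyhedron, hβ.raysOf_cell hσ]
  rw [localSections, hset, Matroid.eRank_restrict, ← (isBasis_inter_of_normalCone hbase
    (by simp [hground]) ?_).encard_eq_eRk, Set.ncard]
  · rfl
  · intro e he f hfB heB hf i hi
    refine (he i hi).trans (le_of_mem_fundCircuit hbase (hap _ (hβ.basis_mem hσ i)).2
      (by simp [hground]) heB hf ?_)
    rintro rfl
    exact heB hfB

open Classical in
/-- A localization formula for the Euler characteristic, depending on a generic direction. -/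
theorem eulerChar_eq_sum_maxCones (hs : S.IsSmooth) (hc : S.IsComplete) {ξ : Fin d → ℝ}
    (hξ : S.Generic ξ) (u : Fin d → ℤ) :
    E.eulerChar u = ∑ σ ∈ S.maxCones, ∑ e with e ∈ A σ, ∏ i,
      (if 0 < coord (β σ) i ξ then
        (if latticePt u ⬝ᵥ latticePt (β σ i) ≤ E.Phi (latticePt (β σ i)) e then 0 else -1)
      else (if latticePt u ⬝ᵥ latticePt (β σ i) ≤ E.Phi (latticePt (β σ i)) e then 1 else 0) :
        ℤ) := by
  rw [eulerChar, hβ.sum_cones hs hc hξ]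
  refine Finset.sum_congr rfl fun σ hσ => ?_
  have h : ∀ I : Finset (Fin d),
      (-1 : ℤ) ^ coneCodim (cell (β σ) I) *
        ((E.localSections (cell (β σ) I) u).eRank.toNat : ℤ) =
      ∑ e with e ∈ A σ, (-1 : ℤ) ^ (d - I.card) * (if ∀ i ∈ I,
        latticePt u ⬝ᵥ latticePt (β σ i) ≤ E.Phi (latticePt (β σ i)) e then 1 else 0) := by
    intro I
    rw [rank_localSections_cell hβ hA hground hσ, coneCodim_cell, ← Finset.mul_sum]
    congr 1
    rw [Finset.sum_ite, Finset.sum_const_zero, add_zero, Finset.sum_const, nsmul_one,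
      Set.ncard_eq_toFinset_card', Finset.filter_filter]
    congr 2
    ext e
    simp
  simp_rw [h]
  rw [Finset.sum_comm]
  exact Finset.sum_congr rfl fun e _ => sum_sign_filter_eq_prod _ _

end TropicalToricVectorBundle

/-! ### Ampleness as strict convexity -/

namespace ToricLineBundle

open ToricFan

variable {d : ℕ} {S : ToricFan d} {L : ToricLineBundle S}
  {β : PointedCone ℝ (Fin d → ℝ) → Module.Basis (Fin d) ℤ (Fin d → ℤ)}

theorem IsAmple.exists_eq_normalCone (hL : L.IsAmple) {σ : PointedCone ℝ (Fin d → ℝ)}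
    (hσ : σ ∈ S.cones) : ∃ m ∈ L.momentPolyhedron, σ = normalCone L.momentPolyhedron m := by
  have h : σ ∈ outerNormalFan L.momentPolyhedron := by rw [hL]; exact_mod_cast hσ
  exact h

theorem exists_add_smul_mem_momentPolyhedron (hfin : S.rays.Finite) {y : Fin d → ℝ}
    (hy : ∀ v ∈ S.rays, y ⬝ᵥ latticePt v < L.psi (latticePt v)) (z : Fin d → ℝ) :
    ∃ ε : ℝ, 0 < ε ∧ y + ε • z ∈ L.momentPolyhedron := by
  have h : ∀ v ∈ hfin.toFinset, ∀ᶠ ε : ℝ in 𝓝[>] 0,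
      (y + ε • z) ⬝ᵥ latticePt v ≤ L.psi (latticePt v) := by
    intro v hv
    rw [Set.Finite.mem_toFinset] at hv
    have hcont : Tendsto (fun ε : ℝ => y ⬝ᵥ latticePt v + ε * (z ⬝ᵥ latticePt v)) (𝓝[>] 0)
        (𝓝 (y ⬝ᵥ latticePt v)) := by
      have : Continuous fun ε : ℝ => y ⬝ᵥ latticePt v + ε * (z ⬝ᵥ latticePt v) := by fun_prop
      have h := this.tendsto 0
      simp only [zero_mul, add_zero] at h
      exact h.mono_left nhdsWithin_le_nhds
    filter_upwards [hcont.eventually_lt_const (hy v hv)] with ε hε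
    rw [add_dotProduct, smul_dotProduct, smul_eq_mul]
    exact hε.le
  obtain ⟨ε, h1, h2⟩ := (((eventually_all_finset _).2 h).and self_mem_nhdsWithin).exists
  exact ⟨ε, h2, fun v hv => h1 v (hfin.mem_toFinset.2 hv)⟩

/-- For an ample line bundle, each ray contributes a facet of the moment polytope. -/
theorem IsAmple.exists_tight (hL : L.IsAmple) (hs : S.IsSmooth) (hfin : S.rays.Finite)
    {v : Fin d → ℤ} (hv : v ∈ S.rays) :
    ∃ y ∈ L.momentPolyhedron, y ⬝ᵥ latticePt v = L.psi (latticePt v) := by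
  obtain ⟨y, hy, hN⟩ := hL.exists_eq_normalCone hv.2
  have hvN : latticePt v ∈ normalCone L.momentPolyhedron y := hN ▸ Submodule.subset_span rfl
  refine ⟨y, hy, le_antisymm (hy v hv) ?_⟩
  by_contra! hlt
  -- A tight ray `w` would lie in the normal cone at `y`, which is the ray of `v`. Then `w = v`,
  -- which is not tight by assumption.
  have hstrict : ∀ w ∈ S.rays, y ⬝ᵥ latticePt w < L.psi (latticePt w) := by
    intro w hw
    refine lt_of_le_of_ne (hy w hw) fun heq => ?_
    have hwN : latticePt w ∈ normalCone L.momentPolyhedron y := fun y' hy' => by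
      rw [heq]; exact hy' w hw
    rw [← hN] at hwN
    obtain ⟨b, I, hI⟩ := hs.exists_eq_cell hv.2
    obtain ⟨c, hc⟩ := Submodule.mem_span_singleton.1 hwN
    have hc' : (c : ℝ) • latticePt v = latticePt w := hc
    have hcpos : (0 : ℝ) < c := by
      refine lt_of_le_of_ne c.2 fun h0 => latticePt_ne_zero_of_isPrimitiveVec hw.1 ?_
      rw [← hc', ← h0, zero_smul]
    have hle : PointedCone.hull ℝ {latticePt w} = PointedCone.hull ℝ {latticePt v} := by
      refine le_antisymm (Submodule.span_le.2 ?_) (Submodule.span_le.2 ?_)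
      · rintro _ rfl; exact hwN
      · rintro _ rfl
        have h3 := smul_mem_cone (inv_nonneg.2 hcpos.le)
          (Submodule.subset_span (R := {c : ℝ // 0 ≤ c}) (Set.mem_singleton (latticePt w)))
        rwa [← hc', smul_smul, inv_mul_cancel₀ hcpos.ne', one_smul, hc'] at h3
    rw [hI] at hle
    obtain ⟨i, -, rfl⟩ := eq_basis_of_hull_eq_cell hw.1 hle
    obtain ⟨j, -, rfl⟩ := eq_basis_of_hull_eq_cell hv.1 hI
    have h4 := congrArg (coord b i) hc'
    rw [map_smul, coord_basis_self, coord_basis] at h4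
    split_ifs at h4 with hij
    · subst hij; exact hlt.ne heq
    · simp at h4
  -- With no tight inequality, `y` can move in the direction `v` inside the polyhedron, although the
  -- functional `v` is maximal at `y`.
  obtain ⟨ε, hε, hmem⟩ := exists_add_smul_mem_momentPolyhedron hfin hstrict (latticePt v)
  have h1 := hvN _ hmem
  rw [add_dotProduct, smul_dotProduct, smul_eq_mul] at h1
  have h2 : 0 < latticePt v ⬝ᵥ latticePt v := by
    simpa using Matrix.dotProduct_star_self_pos_iff.2 (latticePt_ne_zero_of_isPrimitiveVec hv.1)
  have := mul_pos hε h2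
  linarith

/-- The vertices of the moment polytope of an ample line bundle: they represent `ψ` on the
full-dimensional cones, and lie strictly below `ψ` elsewhere. -/
structure IsVertexChoice (L : ToricLineBundle S)
    (m : PointedCone ℝ (Fin d → ℝ) → Fin d → ℝ) : Prop where
  eq_psi : ∀ σ ∈ S.maxCones, ∀ x ∈ σ, m σ ⬝ᵥ x = L.psi x
  lt_psi : ∀ σ ∈ S.maxCones, ∀ x ∉ σ, m σ ⬝ᵥ x < L.psi x

/-- Take for `m σ` a point of the polytope with normal cone `σ`. It maximizes the generators of `σ`,
and these maxima are the values of `ψ` by `IsAmple.exists_tight`. Consequently $\psi(x)$ is the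
maximum of the functional $x$ on the polytope, and it is attained at `m σ` only for $x$ in the
normal cone `σ`. -/
theorem IsAmple.exists_isVertexChoice (hL : L.IsAmple) (hs : S.IsSmooth) (hc : S.IsComplete)
    (hβ : S.IsFrame β) : ∃ m, L.IsVertexChoice m := by
  have hfin := hβ.finite_rays hc
  have h : ∀ σ : PointedCone ℝ (Fin d → ℝ), ∃ m : Fin d → ℝ, σ ∈ S.maxCones →
      m ∈ L.momentPolyhedron ∧ σ = normalCone L.momentPolyhedron m := by
    intro σ
    by_cases hσ : σ ∈ S.maxCones
    · obtain ⟨m, h1, h2⟩ := hL.exists_eq_normalCone (mem_cones_of_mem_maxCones hσ)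
      exact ⟨m, fun _ => ⟨h1, h2⟩⟩
    · exact ⟨0, fun h => absurd h hσ⟩
  choose m hm using h
  have heq : ∀ σ ∈ S.maxCones, ∀ x ∈ σ, m σ ⬝ᵥ x = L.psi x := by
    intro σ hσ x hx
    obtain ⟨hP, hN⟩ := hm σ hσ
    obtain ⟨l, hl⟩ := L.linearOn σ (mem_cones_of_mem_maxCones hσ)
    have hray : ∀ i, m σ ⬝ᵥ latticePt (β σ i) = l (latticePt (β σ i)) := by
      intro i
      have hmem := hβ.basis_mem hσ i
      have hr := hβ.basis_mem_rays hσ i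
      rw [← hl _ hmem]
      obtain ⟨y, hy, hyv⟩ := hL.exists_tight hs hfin hr
      refine le_antisymm (hP _ hr) ?_
      rw [← hyv]
      have hmem' : latticePt (β σ i) ∈ normalCone L.momentPolyhedron (m σ) := by
        rw [← hN]; exact hmem
      exact hmem' y hy
    rw [hl x hx, linear_apply_eq_sum_coord (β σ) l x]
    conv_lhs => rw [← sum_coord_smul (β σ) x]
    rw [dotProduct_sum]
    exact Finset.sum_congr rfl fun i _ => by rw [dotProduct_smul, hray, smul_eq_mul]
  refine ⟨m, heq, fun σ hσ x hx => ?_⟩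
  by_contra! hle
  apply hx
  rw [(hm σ hσ).2]
  intro y hy
  obtain ⟨τ, hτ, hxτ⟩ := hβ.exists_mem_maxCone hc x
  refine le_trans ?_ hle
  rw [← heq τ hτ x hxτ]
  rw [(hm τ hτ).2] at hxτ
  exact hxτ y hy

variable {m : PointedCone ℝ (Fin d → ℝ) → Fin d → ℝ}

theorem IsVertexChoice.le_psi (hm : L.IsVertexChoice m) {σ : PointedCone ℝ (Fin d → ℝ)}
    (hσ : σ ∈ S.maxCones) (x : Fin d → ℝ) : m σ ⬝ᵥ x ≤ L.psi x := by
  by_cases hx : x ∈ σ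
  · exact (hm.eq_psi σ hσ x hx).le
  · exact (hm.lt_psi σ hσ x hx).le

theorem IsVertexChoice.psi_add_le (hm : L.IsVertexChoice m) (hβ : S.IsFrame β)
    (hc : S.IsComplete) (x y : Fin d → ℝ) : L.psi (x + y) ≤ L.psi x + L.psi y := by
  obtain ⟨σ, hσ, h⟩ := hβ.exists_mem_maxCone hc (x + y)
  rw [← hm.eq_psi σ hσ _ h, dotProduct_add]
  exact add_le_add (hm.le_psi hσ x) (hm.le_psi hσ y)

theorem IsVertexChoice.psi_smul (hm : L.IsVertexChoice m) (hβ : S.IsFrame β)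
    (hc : S.IsComplete) {c : ℝ} (h0 : 0 ≤ c) (x : Fin d → ℝ) :
    L.psi (c • x) = c * L.psi x := by
  obtain ⟨σ, hσ, h⟩ := hβ.exists_mem_maxCone hc x
  rw [← hm.eq_psi σ hσ _ h, ← hm.eq_psi σ hσ _ (smul_mem_cone h0 h), dotProduct_smul, smul_eq_mul]

/-- The moment polytope of an ample line bundle is full-dimensional. -/
theorem IsAmple.exists_interior (hL : L.IsAmple) (hfin : S.rays.Finite) :
    ∃ y : Fin d → ℝ, ∃ ε : ℝ, 0 < ε ∧
      ∀ v ∈ S.rays, y ⬝ᵥ latticePt v + ε ≤ L.psi (latticePt v) := by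
  obtain ⟨σ, hσ⟩ := S.nonempty
  -- By strong convexity the zero cone is a face, hence the normal cone of some `y`. No inequality
  -- is tight at such a `y`.
  have hbot : (⊥ : PointedCone ℝ (Fin d → ℝ)) ∈ S.cones := by
    refine S.face_mem σ hσ _ ⟨bot_le, fun {x y a} hx hy ha hxy => ?_⟩
    rw [Submodule.mem_bot] at hxy ⊢
    have h1 : -(a • x) = y := by rw [eq_comm, ← sub_eq_zero, sub_neg_eq_add, add_comm, hxy]
    have h2 := S.stronglyConvex σ hσ (a • x) (smul_mem_cone ha.le hx) (h1 ▸ hy)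
    exact (smul_eq_zero.1 h2).resolve_left ha.ne'
  obtain ⟨y, hy, hN⟩ := hL.exists_eq_normalCone hbot
  have hlt : ∀ v ∈ S.rays, y ⬝ᵥ latticePt v < L.psi (latticePt v) := by
    intro v hv
    refine lt_of_le_of_ne (hy v hv) fun heq => latticePt_ne_zero_of_isPrimitiveVec hv.1 ?_
    rw [← Submodule.mem_bot (R := {c : ℝ // 0 ≤ c}), hN]
    intro y' hy'
    rw [heq]
    exact hy' v hv
  have h : ∀ v ∈ hfin.toFinset, ∀ᶠ ε : ℝ in 𝓝[>] 0,
      y ⬝ᵥ latticePt v + ε ≤ L.psi (latticePt v) := by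
    intro v hv
    filter_upwards [Ioo_mem_nhdsGT (sub_pos.2 (hlt v (hfin.mem_toFinset.1 hv)))] with ε hε
    linarith [hε.2]
  obtain ⟨ε, h1, h2⟩ := (((eventually_all_finset _).2 h).and self_mem_nhdsWithin).exists
  exact ⟨y, ε, h2, fun v hv => h1 v (hfin.mem_toFinset.2 hv)⟩

end ToricLineBundle

/-! ### Equality of the Euler characteristic and the rank of global sections for large twists -/

namespace TropicalToricVectorBundle

open ToricFan

variable {d : ℕ} {S : ToricFan d} {α : Type*} [Fintype α] {𝓜 : Matroid α}
  {β : PointedCone ℝ (Fin d → ℝ) → Module.Basis (Fin d) ℤ (Fin d → ℤ)}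

/-- A norm-like function adapted to a frame of the fan. -/
noncomputable def frameNorm (S : ToricFan d)
    (β : PointedCone ℝ (Fin d → ℝ) → Module.Basis (Fin d) ℤ (Fin d → ℤ)) (x : Fin d → ℝ) : ℝ :=
  ∑ σ ∈ S.maxCones, ∑ i, |coord (β σ) i x|

theorem frameNorm_nonneg (x : Fin d → ℝ) : 0 ≤ frameNorm S β x :=
  Finset.sum_nonneg fun _ _ => Finset.sum_nonneg fun _ _ => abs_nonneg _

theorem sum_abs_coord_le_frameNorm {σ : PointedCone ℝ (Fin d → ℝ)} (hσ : σ ∈ S.maxCones)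
    (x : Fin d → ℝ) : ∑ i, |coord (β σ) i x| ≤ frameNorm S β x :=
  Finset.single_le_sum (f := fun σ => ∑ i, |coord (β σ) i x|)
    (fun _ _ => Finset.sum_nonneg fun _ _ => abs_nonneg _) hσ

theorem frameNorm_add_le (x y : Fin d → ℝ) :
    frameNorm S β (x + y) ≤ frameNorm S β x + frameNorm S β y := by
  simp only [frameNorm, ← Finset.sum_add_distrib, map_add]
  exact Finset.sum_le_sum fun _ _ => Finset.sum_le_sum fun _ _ => abs_add_le _ _

theorem frameNorm_smul (c : ℝ) (x : Fin d → ℝ) :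
    frameNorm S β (c • x) = |c| * frameNorm S β x := by
  simp only [frameNorm, map_smul, smul_eq_mul, abs_mul, Finset.mul_sum]

theorem frameNorm_sum_le {ι : Type*} (s : Finset ι) (f : ι → Fin d → ℝ) :
    frameNorm S β (∑ i ∈ s, f i) ≤ ∑ i ∈ s, frameNorm S β (f i) :=
  Finset.le_sum_of_subadditive _ (by simp [frameNorm]) frameNorm_add_le s f

/-- A common bound for the absolute values of the diagram of the bundle. -/
def IsBound (E : TropicalToricVectorBundle S 𝓜) (C : ℝ) : Prop :=
  0 ≤ C ∧ ∀ v ∈ S.rays, ∀ e, |E.Phi (latticePt v) e| ≤ C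

theorem exists_isBound (E : TropicalToricVectorBundle S 𝓜) (hfin : S.rays.Finite) :
    ∃ C, E.IsBound C := by
  refine ⟨∑ v ∈ hfin.toFinset, ∑ e, |E.Phi (latticePt v) e|,
    Finset.sum_nonneg fun _ _ => Finset.sum_nonneg fun _ _ => abs_nonneg _, fun v hv e => ?_⟩
  refine le_trans ?_ (Finset.single_le_sum (f := fun v => ∑ e, |E.Phi (latticePt v) e|)
    (fun _ _ => Finset.sum_nonneg fun _ _ => abs_nonneg _) (hfin.mem_toFinset.2 hv))
  exact Finset.single_le_sum (f := fun e => |E.Phi (latticePt v) e|)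
    (fun _ _ => abs_nonneg _) (Finset.mem_univ e)

/-- The excess of `n ψ` over the linear function `u`. -/
def excess (L : ToricLineBundle S) (n : ℕ) (u : Fin d → ℤ) (x : Fin d → ℝ) : ℝ :=
  n * L.psi x - latticePt u ⬝ᵥ x

theorem le_tensor_pow_iff (E : TropicalToricVectorBundle S 𝓜) (L : ToricLineBundle S) (n : ℕ)
    (u : Fin d → ℤ) (x : Fin d → ℝ) (e : α) :
    latticePt u ⬝ᵥ x ≤ (E.tensor (L.pow n)).Phi x e ↔ -E.Phi x e ≤ excess L n u x := by
  have : (E.tensor (L.pow n)).Phi x e = E.Phi x e + n * L.psi x := rfl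
  rw [this, excess]
  constructor <;> intro h <;> linarith

theorem h0Weight_eq_zero_of_ray (E : TropicalToricVectorBundle S 𝓜) {u v : Fin d → ℤ}
    (hv : v ∈ S.rays) (h : ∀ e, ¬ latticePt u ⬝ᵥ latticePt v ≤ E.Phi (latticePt v) e) :
    E.h0Weight u = 0 := by
  have hset : {e ∈ 𝓜.E | latticePt u ∈ E.polyhedron e} = ∅ :=
    Set.eq_empty_of_forall_notMem fun e he => h e (he.2 v hv)
  rw [h0Weight, globalSections, hset, Matroid.eRank_restrict, Matroid.eRk_empty]
  rfl

variable {E : TropicalToricVectorBundle S 𝓜} {A : PointedCone ℝ (Fin d → ℝ) → Set α}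
  {L : ToricLineBundle S} {m : PointedCone ℝ (Fin d → ℝ) → Fin d → ℝ} {C : ℝ}

/-- The left side is the linear extension of the excess from `σ`, which lies below the excess by
convexity of `ψ`. The coordinates of `x` may be negative. -/
theorem excess_ge_sum_coord (hβ : S.IsFrame β) (hm : L.IsVertexChoice m) (n : ℕ)
    (u : Fin d → ℤ) {σ : PointedCone ℝ (Fin d → ℝ)} (hσ : σ ∈ S.maxCones) (x : Fin d → ℝ) :
    ∑ i, coord (β σ) i x * excess L n u (latticePt (β σ i)) ≤ excess L n u x := by
  have h1 : ∀ i, excess L n u (latticePt (β σ i)) =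
      (n : ℝ) * (m σ ⬝ᵥ latticePt (β σ i)) - latticePt u ⬝ᵥ latticePt (β σ i) := fun i => by
    rw [excess, hm.eq_psi σ hσ _ (hβ.basis_mem hσ i)]
  have h2 : ∑ i, coord (β σ) i x * excess L n u (latticePt (β σ i)) =
      n * (m σ ⬝ᵥ x) - latticePt u ⬝ᵥ x := by
    conv_rhs => rw [← sum_coord_smul (β σ) x]
    simp_rw [h1, dotProduct_sum, dotProduct_smul, Finset.mul_sum, smul_eq_mul]
    rw [← Finset.sum_sub_distrib]
    exact Finset.sum_congr rfl fun i _ => by ring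
  rw [h2, excess]
  have := mul_le_mul_of_nonneg_left (hm.le_psi hσ x) (Nat.cast_nonneg (α := ℝ) n)
  linarith

section

variable (hβ : S.IsFrame β) (hs : S.IsSmooth) (hc : S.IsComplete) (hA : E.IsApartmentChoice A)
  (hground : 𝓜.E = Set.univ) (hm : L.IsVertexChoice m) (hC : E.IsBound C)
include hβ hc hm hC

/-- On a cone containing `x`, the strongly negative excess must already show at a generator with
excess below `-C`. There the section condition fails for every `e`. -/
theorem h0Weight_eq_zero_of_excess_lt {n : ℕ} {u : Fin d → ℤ} {x : Fin d → ℝ}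
    (h : excess L n u x < -C * frameNorm S β x) : (E.tensor (L.pow n)).h0Weight u = 0 := by
  obtain ⟨σ, hσ, hxσ⟩ := hβ.exists_mem_maxCone hc x
  have hx := (hβ.mem_iff hσ).1 hxσ
  obtain ⟨i, hi⟩ : ∃ i, excess L n u (latticePt (β σ i)) < -C := by
    by_contra! hcon
    have h1 := excess_ge_sum_coord hβ hm n u hσ x
    have h2 : ∑ i, coord (β σ) i x * (-C) ≤
        ∑ i, coord (β σ) i x * excess L n u (latticePt (β σ i)) :=
      Finset.sum_le_sum fun i _ => mul_le_mul_of_nonneg_left (hcon i) (hx i)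
    have h3 := sum_abs_coord_le_frameNorm (β := β) hσ x
    rw [Finset.sum_congr rfl fun i _ => abs_of_nonneg (hx i)] at h3
    rw [← Finset.sum_mul] at h2
    have h4 := mul_le_mul_of_nonneg_left h3 hC.1
    linarith
  refine h0Weight_eq_zero_of_ray _ (hβ.basis_mem_rays hσ i) fun e he => ?_
  rw [le_tensor_pow_iff] at he
  have := (abs_le.1 (hC.2 _ (hβ.basis_mem_rays hσ i) e)).2
  linarith

include hs hA hground in
-- Localizing along `-x`, a nonzero product at any `σ` bounds each term of the linear extension of
-- the excess below by $-C$ times the absolute coordinate of `x`. By `excess_ge_sum_coord` this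
-- contradicts the assumption.
theorem eulerChar_eq_zero_of_excess_lt {n : ℕ} {u : Fin d → ℤ} {x : Fin d → ℝ}
    (hx : S.Generic x) (h : excess L n u x < -C * frameNorm S β x) :
    (E.tensor (L.pow n)).eulerChar u = 0 := by
  classical
  rw [eulerChar_eq_sum_maxCones hβ (hA.tensor (L.pow n)) hground hs hc hx.neg]
  refine Finset.sum_eq_zero fun σ hσ => Finset.sum_eq_zero fun e _ => ?_
  by_contra hne
  rw [← Ne, Finset.prod_ne_zero_iff] at hne
  -- A nonzero factor means that the section condition fails where the coordinate of `x` is negative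
  -- (excess at most `C`) and holds where it is nonnegative (excess at least `-C`).
  have hterm : ∀ i, -C * |coord (β σ) i x| ≤
      coord (β σ) i x * excess L n u (latticePt (β σ i)) := by
    intro i
    have hi := hne i (Finset.mem_univ i)
    simp only [le_tensor_pow_iff, map_neg, neg_pos] at hi
    have hb := abs_le.1 (hC.2 _ (hβ.basis_mem_rays hσ i) e)
    split_ifs at hi with h1 h2 h2
    · simp at hi
    · rw [abs_of_neg h1]
      have : excess L n u (latticePt (β σ i)) ≤ C := by linarith
      have := mul_le_mul_of_nonpos_left this h1.le
      linarith
    · rw [abs_of_nonneg (not_lt.1 h1)]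
      have : -C ≤ excess L n u (latticePt (β σ i)) := by linarith
      have := mul_le_mul_of_nonneg_left this (not_lt.1 h1)
      linarith
    · simp at hi
  have h1 := excess_ge_sum_coord hβ hm n u hσ x
  have h2 := Finset.sum_le_sum fun i (_ : i ∈ Finset.univ) => hterm i
  rw [← Finset.mul_sum] at h2
  have h3 := mul_le_mul_of_nonneg_left (sum_abs_coord_le_frameNorm (β := β) hσ x) hC.1
  linarith

omit hC in
theorem excess_add_smul_le (n : ℕ) (u : Fin d → ℤ) (x ζ : Fin d → ℝ) {t : ℝ} (ht : 0 ≤ t) :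
    excess L n u (x + t • ζ) ≤ excess L n u x + t * excess L n u ζ := by
  have h1 := hm.psi_add_le hβ hc x (t • ζ)
  rw [hm.psi_smul hβ hc ht] at h1
  have := mul_le_mul_of_nonneg_left h1 (Nat.cast_nonneg (α := ℝ) n)
  simp only [excess, dotProduct_add, dotProduct_smul, smul_eq_mul]
  linarith

/-- By sublinearity of the excess and of the norm, a strict violation at `x` survives a small
displacement to a generic point. -/
theorem excess_ge_of_generic {n : ℕ} {u : Fin d → ℤ}
    (h : ∀ x, S.Generic x → -C * frameNorm S β x ≤ excess L n u x) (x : Fin d → ℝ) :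
    -C * frameNorm S β x ≤ excess L n u x := by
  obtain ⟨ζ, hζ⟩ := S.exists_generic
  by_contra! hlt
  have hcont : Tendsto (fun t : ℝ => excess L n u x + C * frameNorm S β x +
      t * (excess L n u ζ + C * frameNorm S β ζ)) (𝓝[>] 0)
      (𝓝 (excess L n u x + C * frameNorm S β x)) := by
    have : Continuous fun t : ℝ => excess L n u x + C * frameNorm S β x +
      t * (excess L n u ζ + C * frameNorm S β ζ) := by fun_prop
    have h := this.tendsto 0
    simp only [zero_mul, add_zero] at h
    exact h.mono_left nhdsWithin_le_nhds
  obtain ⟨t, ⟨h1, h2⟩, h3⟩ := (((hcont.eventually_lt_const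
    (show _ < (0 : ℝ) by linarith)).and (hζ.eventually_add_smul x)).and self_mem_nhdsWithin).exists
  have ht : 0 < t := h3
  have h4 := h _ h2
  have h5 := excess_add_smul_le hβ hc hm n u x ζ ht.le
  have h6 := frameNorm_add_le (S := S) (β := β) x (t • ζ)
  rw [frameNorm_smul, abs_of_pos ht] at h6
  have h7 := mul_le_mul_of_nonneg_left h6 hC.1
  linarith

/-- If the weight `u` is not far outside the `n`-th multiple of the moment polytope and `n` is
large, then the facets that `u` is close to have a common vertex. -/
theorem exists_maxCone_of_excess_ge : ∃ N₀ : ℕ, 0 < N₀ ∧ ∀ n : ℕ, N₀ ≤ n → ∀ u : Fin d → ℤ,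
    (∀ x, -C * frameNorm S β x ≤ excess L n u x) →
    ∃ τ ∈ S.maxCones, ∀ v ∈ S.rays, excess L n u (latticePt v) ≤ C → latticePt v ∈ τ := by
  classical
  have hfin := hβ.finite_rays hc
  -- A uniform gap exists because there are finitely many pairs of a cone and a ray.
  obtain ⟨δ, hδ, hgap⟩ : ∃ δ : ℝ, 0 < δ ∧ ∀ σ ∈ S.maxCones, ∀ v ∈ S.rays, latticePt v ∉ σ →
      m σ ⬝ᵥ latticePt v + δ ≤ L.psi (latticePt v) := by
    have h : ∀ p ∈ S.maxCones ×ˢ hfin.toFinset, ∀ᶠ δ : ℝ in 𝓝[>] 0, latticePt p.2 ∉ p.1 →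
        m p.1 ⬝ᵥ latticePt p.2 + δ ≤ L.psi (latticePt p.2) := by
      rintro ⟨σ, v⟩ hp
      by_cases hv : latticePt v ∈ σ
      · exact Eventually.of_forall fun _ h => absurd hv h
      · have := hm.lt_psi σ (Finset.mem_product.1 hp).1 _ hv
        filter_upwards [Ioo_mem_nhdsGT (sub_pos.2 this)] with δ hδ _
        linarith [hδ.2]
    obtain ⟨δ, h1, h2⟩ := (((eventually_all_finset _).2 h).and self_mem_nhdsWithin).exists
    exact ⟨δ, h2, fun σ hσ v hv =>
      h1 (σ, v) (Finset.mem_product.2 ⟨hσ, hfin.mem_toFinset.2 hv⟩)⟩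
  set K : ℝ := ∑ v ∈ hfin.toFinset, (C + C * frameNorm S β (latticePt v)) with hK
  obtain ⟨N₀, hN₀⟩ := exists_nat_gt (K / δ)
  refine ⟨N₀ + 1, Nat.succ_pos _, fun n hn u hu => ?_⟩
  set R := hfin.toFinset.filter fun v => excess L n u (latticePt v) ≤ C with hR
  -- The lower bound is tested at the sum of all rays of small excess. If one of them is outside the
  -- cone `τ` of the sum, convexity costs at least `n * δ`, while the other contributions are
  -- bounded by `K` independently of `n`.
  obtain ⟨τ, hτ, hmem⟩ := hβ.exists_mem_maxCone hc (∑ v ∈ R, latticePt v)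
  refine ⟨τ, hτ, fun v hv hact => ?_⟩
  by_contra hvτ
  have hvR : v ∈ R := Finset.mem_filter.2 ⟨hfin.mem_toFinset.2 hv, hact⟩
  have h1 := hu (∑ v ∈ R, latticePt v)
  have h2 : excess L n u (∑ v ∈ R, latticePt v) =
      ∑ v ∈ R, (excess L n u (latticePt v) -
        n * (L.psi (latticePt v) - m τ ⬝ᵥ latticePt v)) := by
    rw [excess, ← hm.eq_psi τ hτ _ hmem, dotProduct_sum, dotProduct_sum, Finset.mul_sum,
      ← Finset.sum_sub_distrib]
    exact Finset.sum_congr rfl fun v _ => by rw [excess]; ring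
  have h3 : ∑ v ∈ R, (excess L n u (latticePt v) -
      n * (L.psi (latticePt v) - m τ ⬝ᵥ latticePt v)) ≤ ∑ w ∈ R, (C - if w = v then n * δ else 0) := by
    refine Finset.sum_le_sum fun w hw => ?_
    have hw1 := (Finset.mem_filter.1 hw).2
    have hn0 : (0 : ℝ) ≤ n := Nat.cast_nonneg n
    split_ifs with hwv
    · subst hwv
      have h := hgap τ hτ w hv hvτ
      have : (n : ℝ) * δ ≤ n * (L.psi (latticePt w) - m τ ⬝ᵥ latticePt w) :=
        mul_le_mul_of_nonneg_left (by linarith) hn0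
      linarith
    · have : 0 ≤ (n : ℝ) * (L.psi (latticePt w) - m τ ⬝ᵥ latticePt w) :=
        mul_nonneg hn0 (sub_nonneg.2 (hm.le_psi hτ _))
      linarith
  rw [← h2, Finset.sum_sub_distrib, Finset.sum_ite_eq', if_pos hvR] at h3
  have h4 := mul_le_mul_of_nonneg_left
    (frameNorm_sum_le (S := S) (β := β) R fun v => latticePt v) hC.1
  have h5 : ∑ v ∈ R, C + C * ∑ v ∈ R, frameNorm S β (latticePt v) ≤ K := by
    rw [Finset.mul_sum, ← Finset.sum_add_distrib]
    refine Finset.sum_le_sum_of_subset_of_nonneg (Finset.filter_subset _ _) fun v _ _ => ?_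
    exact add_nonneg hC.1 (mul_nonneg hC.1 (frameNorm_nonneg _))
  have h6 : K < n * δ := by
    rw [div_lt_iff₀ hδ] at hN₀
    refine hN₀.trans_le (mul_le_mul_of_nonneg_right ?_ hδ.le)
    exact_mod_cast (Nat.le_succ N₀).trans hn
  linarith

include hs hA hground in
omit hm in
-- Localize along `-x` with `x` generic in the interior of `τ`. All factors at `τ` are then plain
-- indicators, which count the sections over $U_\tau$; rays outside `τ` have excess above `C` and
-- impose no condition.
theorem eulerChar_eq_h0Weight_of_maxCone {n : ℕ} {u : Fin d → ℤ}
    {τ : PointedCone ℝ (Fin d → ℝ)} (hτ : τ ∈ S.maxCones)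
    (h : ∀ v ∈ S.rays, excess L n u (latticePt v) ≤ C → latticePt v ∈ τ) :
    (E.tensor (L.pow n)).eulerChar u = (E.tensor (L.pow n)).h0Weight u := by
  classical
  obtain ⟨x, hx, hpos⟩ : ∃ x, S.Generic x ∧ ∀ i, 0 < coord (β τ) i x := by
    obtain ⟨ζ, hζ⟩ := S.exists_generic
    have hev : ∀ᶠ t : ℝ in 𝓝[>] 0, ∀ i, 0 < coord (β τ) i (∑ j, latticePt (β τ j) + t • ζ) := by
      rw [eventually_all]
      intro i
      have hcont : Tendsto (fun t : ℝ => 1 + t * coord (β τ) i ζ) (𝓝[>] 0) (𝓝 1) := by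
        have : Continuous fun t : ℝ => 1 + t * coord (β τ) i ζ := by fun_prop
        have h := this.tendsto 0
        simp only [zero_mul, add_zero] at h
        exact h.mono_left nhdsWithin_le_nhds
      filter_upwards [hcont.eventually_const_lt one_pos] with t ht
      simpa [coord_basis] using ht
    obtain ⟨t, h1, h2⟩ := (hev.and (hζ.eventually_add_smul _)).exists
    exact ⟨_, h2, h1⟩
  rw [eulerChar_eq_sum_maxCones hβ (hA.tensor (L.pow n)) hground hs hc hx.neg,
    Finset.sum_eq_single_of_mem τ hτ]
  · have hset : {e ∈ 𝓜.E | latticePt u ∈ (E.tensor (L.pow n)).polyhedron e} =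
        {e ∈ 𝓜.E | latticePt u ∈ (E.tensor (L.pow n)).localPolyhedron e τ} := by
      ext e
      refine and_congr_right fun _ => ⟨fun he v hv => he v hv.1, fun he v hv => ?_⟩
      by_cases hvτ : latticePt v ∈ τ
      · exact he v ⟨hv, hvτ⟩
      · rw [le_tensor_pow_iff]
        have h1 := (abs_le.1 (hC.2 v hv e)).1
        have h2 : C < excess L n u (latticePt v) := by
          by_contra! hcon
          exact hvτ (h v hv hcon)
        linarith
    have hrank := rank_localSections_cell hβ (hA.tensor (L.pow n)) hground hτ Finset.univ u
    rw [← hβ τ hτ] at hrank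
    rw [h0Weight, globalSections, hset, ← localSections, hrank, Set.ncard_eq_toFinset_card']
    have hneg : ∀ i, ¬ 0 < coord (β τ) i (-x) := fun i => by
      rw [map_neg]; linarith [hpos i]
    simp only [hneg, if_false, Finset.prod_ite_zero, Finset.prod_const_one]
    rw [Finset.sum_ite, Finset.sum_const_zero, add_zero, Finset.sum_const, nsmul_one,
      Finset.filter_filter]
    congr 2
    ext e
    simp
  · intro σ hσ hne
    refine Finset.sum_eq_zero fun e _ => ?_
    by_contra hprod
    rw [← Ne, Finset.prod_ne_zero_iff] at hprod
    -- In a nonzero product at `σ`, the generators at which `x` has a negative coordinate have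
    -- excess at most `C`, so they lie in `τ`. The positive part of `x` in the frame of `σ` equals
    -- `x` plus a nonnegative combination of these generators, hence is interior to `τ`, while it
    -- also lies in `σ`.
    refine hne (hβ.eq_of_interior hτ hσ
      (q := ∑ i, max (coord (β σ) i x) 0 • latticePt (β σ i)) ?_ ?_).symm
    · intro j
      have hdec : ∑ i, max (coord (β σ) i x) 0 • latticePt (β σ i) =
          x + ∑ i, max (-coord (β σ) i x) 0 • latticePt (β σ i) := by
        conv_rhs => enter [1]; rw [← sum_coord_smul (β σ) x]
        rw [← Finset.sum_add_distrib]
        refine Finset.sum_congr rfl fun i _ => ?_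
        rw [← add_smul]
        congr 1
        rcases le_total 0 (coord (β σ) i x) with h0 | h0
        · rw [max_eq_left h0, max_eq_right (neg_nonpos.2 h0), add_zero]
        · rw [max_eq_right h0, max_eq_left (neg_nonneg.2 h0), add_neg_cancel]
      rw [hdec, map_add, map_sum]
      refine add_pos_of_pos_of_nonneg (hpos j) (Finset.sum_nonneg fun i _ => ?_)
      rw [map_smul, smul_eq_mul]
      rcases le_or_gt 0 (coord (β σ) i x) with h0 | h0
      · rw [max_eq_right (neg_nonpos.2 h0), zero_mul]
      · refine mul_nonneg (le_max_right _ _) ((hβ.mem_iff hτ).1 ?_ j)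
        have hi := hprod i (Finset.mem_univ i)
        simp only [le_tensor_pow_iff, map_neg, neg_pos, if_pos h0] at hi
        refine h _ (hβ.basis_mem_rays hσ i) ?_
        have hb := abs_le.1 (hC.2 _ (hβ.basis_mem_rays hσ i) e)
        split_ifs at hi with h1
        · simp at hi
        · linarith
    · exact Submodule.sum_mem _ fun i _ =>
        smul_mem_cone (le_max_right _ _) (hβ.basis_mem hσ i)

include hs hA hground in
theorem exists_eulerChar_eq_h0Weight : ∃ N₀ : ℕ, 0 < N₀ ∧ ∀ n : ℕ, N₀ ≤ n → ∀ u : Fin d → ℤ,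
    (E.tensor (L.pow n)).eulerChar u = (E.tensor (L.pow n)).h0Weight u := by
  obtain ⟨N₀, hpos, hN₀⟩ := exists_maxCone_of_excess_ge hβ hc hm hC
  refine ⟨N₀, hpos, fun n hn u => ?_⟩
  by_cases hex : ∃ x, S.Generic x ∧ excess L n u x < -C * frameNorm S β x
  · obtain ⟨x, hx, hlt⟩ := hex
    rw [eulerChar_eq_zero_of_excess_lt hβ hs hc hA hground hm hC hx hlt,
      h0Weight_eq_zero_of_excess_lt hβ hc hm hC hlt, Nat.cast_zero]
  · push Not at hex
    obtain ⟨τ, hτ, h⟩ := hN₀ n hn u (excess_ge_of_generic hβ hc hm hC hex)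
    exact eulerChar_eq_h0Weight_of_maxCone hβ hs hc hA hground hC hτ h

end

end TropicalToricVectorBundle

/-! ### Difference operators on functions of arbitrary support -/

section Translation

variable {M : Type*} [AddCommGroup M]

/-- The action of the group algebra on the functions on the group by translations. -/
noncomputable def translationAction (M : Type*) [AddCommGroup M] :
    AddMonoidAlgebra ℤ M →ₐ[ℤ] Module.End ℤ (M → ℤ) :=
  AddMonoidAlgebra.lift ℤ (Module.End ℤ (M → ℤ)) M
    { toFun := fun w =>
        { toFun := fun f u => f (u - w.toAdd)
          map_add' := fun _ _ => rfl
          map_smul' := fun _ _ => rfl }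
      map_one' := by ext f u; simp
      map_mul' := fun w w' => by
        ext f u
        simp [sub_sub] }

theorem translationAction_single (w : M) (r : ℤ) (f : M → ℤ) (u : M) :
    translationAction M (AddMonoidAlgebra.single w r) f u = r * f (u - w) := by
  simp [translationAction, AddMonoidAlgebra.lift_single]

/-- This links the operators, which also act on the infinite cones, with products in the group
algebra, where evaluation is possible. -/
theorem translationAction_coeff (a b : AddMonoidAlgebra ℤ M) :
    translationAction M a (fun u => b.coeff u) = fun u => (a * b).coeff u := by
  classical
  induction a using AddMonoidAlgebra.induction_linear with
  | zero => ext u; simp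
  | add x y hx hy =>
    ext u
    rw [map_add, LinearMap.add_apply, hx, hy, add_mul]
    simp
  | single w r =>
    induction b using AddMonoidAlgebra.induction_linear with
    | zero => ext u; simp [translationAction_single]
    | add x y hx hy =>
      ext u
      have h1 := congrFun hx u
      have h2 := congrFun hy u
      simp only [translationAction_single] at h1 h2 ⊢
      rw [mul_add, AddMonoidAlgebra.coeff_add, Finsupp.add_apply, mul_add, h1, h2,
        AddMonoidAlgebra.coeff_add, Finsupp.add_apply]
    | single w' r' =>
      ext u
      rw [translationAction_single, AddMonoidAlgebra.single_mul_single]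
      simp only [AddMonoidAlgebra.coeff_single, Finsupp.single_apply, eq_sub_iff_add_eq']
      split_ifs <;> simp

/-- The operators that correspond to the edges of a unimodular cone turn a function that is a
product of functions of the coordinates into the product of the differences. -/
theorem translationAction_prod {ι : Type*} [DecidableEq ι] (s t : Finset ι) (hst : s ⊆ t)
    (k : ι → M →+ ℤ) (w : ι → M) (hk : ∀ i j, k j (w i) = if i = j then 1 else 0)
    (θ : ι → ℤ → ℤ) :
    translationAction M (∏ i ∈ s, (1 - AddMonoidAlgebra.single (-w i) 1))
      (fun u => ∏ i ∈ t, θ i (k i u)) =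
      fun u => ∏ i ∈ t, if i ∈ s then θ i (k i u) - θ i (k i u + 1) else θ i (k i u) := by
  induction s using Finset.induction_on with
  | empty => simp
  | insert i s hi ih =>
    have hit : i ∈ t := hst (Finset.mem_insert_self i s)
    rw [Finset.prod_insert hi, map_mul, Module.End.mul_apply,
      ih ((Finset.subset_insert i s).trans hst)]
    ext u
    rw [map_sub, map_one, LinearMap.sub_apply, Module.End.one_apply, Pi.sub_apply,
      translationAction_single, one_mul, sub_neg_eq_add,
      ← Finset.mul_prod_erase t _ hit, ← Finset.mul_prod_erase t _ hit,
      ← Finset.mul_prod_erase t _ hit]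
    -- By duality, translation along `w i` changes only the `i`-th coordinate, so all other factors
    -- split off.
    have h1 : ∀ j ∈ t.erase i, (if j ∈ s then θ j (k j (u + w i)) - θ j (k j (u + w i) + 1) else
        θ j (k j (u + w i))) = if j ∈ insert i s then θ j (k j u) - θ j (k j u + 1) else
        θ j (k j u) := by
      intro j hj
      have hne : i ≠ j := (Finset.ne_of_mem_erase hj).symm
      simp [map_add, hk, hne, hne.symm]
    have h2 : ∀ j ∈ t.erase i, (if j ∈ s then θ j (k j u) - θ j (k j u + 1) else
        θ j (k j u)) = if j ∈ insert i s then θ j (k j u) - θ j (k j u + 1) else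
        θ j (k j u) := by
      intro j hj
      have hne : i ≠ j := (Finset.ne_of_mem_erase hj).symm
      simp [hne.symm]
    rw [Finset.prod_congr rfl h1, Finset.prod_congr rfl h2]
    simp [hi, hk, map_add]
    ring

end Translation

/-! ### Evaluation in power series and polynomial dependence on the exponent -/

section BinomialSeries

open PowerSeries

/-- The evaluation of the group algebra of a lattice along a one-parameter subgroup at `1 + X`. -/
noncomputable def evalOneAddX {M : Type*} [AddCommGroup M] (η : M →+ ℤ) :
    AddMonoidAlgebra ℤ M →ₐ[ℤ] ℚ⟦X⟧ :=
  AddMonoidAlgebra.lift ℤ ℚ⟦X⟧ M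
    { toFun := fun u => binomialSeries ℚ (η u.toAdd)
      map_one' := by simp
      map_mul' := fun u v => by simp }

theorem evalOneAddX_single {M : Type*} [AddCommGroup M] (η : M →+ ℤ) (u : M) :
    evalOneAddX η (AddMonoidAlgebra.single u 1) = binomialSeries ℚ (η u) := by
  rw [evalOneAddX, AddMonoidAlgebra.lift_single, Algebra.smul_def, map_one, one_mul]
  rfl

/-- Setting `X = 0` sends every monomial to `1`; this recovers $h^0$ from the weight generating
function. -/
theorem constantCoeff_evalOneAddX {M : Type*} [AddCommGroup M] (η : M →+ ℤ)
    (a : AddMonoidAlgebra ℤ M) :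
    constantCoeff (evalOneAddX η a) = ∑ u ∈ a.coeff.support, (a.coeff u : ℚ) := by
  rw [evalOneAddX, AddMonoidAlgebra.lift_apply, Finsupp.sum, map_sum]
  refine Finset.sum_congr rfl fun u _ => ?_
  simp

theorem one_sub_binomialSeries_ne_zero {h : ℤ} (hh : h ≠ 0) :
    (1 : ℚ⟦X⟧) - binomialSeries ℚ h ≠ 0 := by
  intro h0
  have := congrArg (coeff 1) h0
  rw [map_sub, binomialSeries_coeff, coeff_one] at this
  simp at this
  exact hh this

theorem exists_polynomial_ringChoose (a m : ℤ) (i : ℕ) :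
    ∃ p : Polynomial ℚ, ∀ n : ℕ, p.eval (n : ℚ) = (Ring.choose (a + n * m) i : ℤ) := by
  refine ⟨Polynomial.C ((i.factorial : ℚ)⁻¹) *
    (descPochhammer ℚ i).comp (Polynomial.C (a : ℚ) + Polynomial.X * Polynomial.C (m : ℚ)),
    fun n => ?_⟩
  have h := Ring.descPochhammer_eq_factorial_smul_choose (a + n * m) i
  rw [← Polynomial.eval_eq_smeval, nsmul_eq_mul] at h
  have h2 := congrArg (Int.cast (R := ℚ)) h
  rw [descPochhammer_eval_cast, Int.cast_mul, Int.cast_natCast] at h2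
  rw [Polynomial.eval_mul, Polynomial.eval_C, Polynomial.eval_comp, inv_mul_eq_iff_eq_mul₀
    (by exact_mod_cast i.factorial_ne_zero), ← h2]
  simp

/-- The value at `1` of the solutions of a family of linear equations with exponential right-hand
sides is a polynomial in the exponent. -/
theorem exists_polynomial_constantCoeff {J : Type*} (s : Finset J) {D : ℚ⟦X⟧} (hD : D ≠ 0)
    (R : J → ℚ⟦X⟧) (a m : J → ℤ) :
    ∃ p : Polynomial ℚ, ∀ n : ℕ, ∀ h : ℚ⟦X⟧,
      D * h = ∑ j ∈ s, R j * binomialSeries ℚ (a j + n * m j) →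
      p.eval (n : ℚ) = constantCoeff h := by
  choose q hq using exists_polynomial_ringChoose
  -- Writing $D=X^K D'$ with $D'(0)=c\ne 0$, the coefficient of $X^K$ in `D * h` is $c\,h(0)$. The
  -- right-hand side makes this coefficient a combination of binomial coefficients in `a j + n * m
  -- j`.
  set K := D.order.toNat
  set c := constantCoeff D.divXPowOrder
  have hc : c ≠ 0 := by
    rw [Ne, constantCoeff_divXPowOrder_eq_zero_iff]
    exact hD
  refine ⟨Polynomial.C c⁻¹ * ∑ j ∈ s, ∑ x ∈ Finset.HasAntidiagonal.antidiagonal K,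
    Polynomial.C (coeff x.1 (R j)) * q (a j) (m j) x.2, fun n h heq => ?_⟩
  have h1 := congrArg (coeff K) heq
  rw [← X_pow_order_mul_divXPowOrder (f := D), mul_assoc] at h1
  have h2 := coeff_X_pow_mul (D.divXPowOrder * h) K 0
  rw [zero_add] at h2
  rw [h2, coeff_zero_eq_constantCoeff_apply, map_mul, map_sum] at h1
  rw [Polynomial.eval_mul, Polynomial.eval_C, Polynomial.eval_finsetSum, inv_mul_eq_iff_eq_mul₀ hc,
    h1]
  refine Finset.sum_congr rfl fun j _ => ?_
  rw [coeff_mul, Polynomial.eval_finsetSum]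
  refine Finset.sum_congr rfl fun x _ => ?_
  rw [Polynomial.eval_mul, Polynomial.eval_C, hq, binomialSeries_coeff]
  simp

end BinomialSeries

/-! ### Integer-valued polynomials -/

section IntegerValued

open Polynomial

/-- A rational polynomial with integer values at all large integers has integer values at all
integers. -/
theorem exists_int_eval_of_eventually {p : ℚ[X]} {N : ℕ}
    (hN : ∀ n : ℕ, N ≤ n → ∃ k : ℤ, p.eval (n : ℚ) = k) (n : ℤ) :
    ∃ k : ℤ, p.eval (n : ℚ) = k := by
  have h : ∀ m : ℕ, ∀ n : ℤ, (N : ℤ) - m ≤ n → ∃ k : ℤ, p.eval (n : ℚ) = k := by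
    intro m
    induction m with
    | zero =>
      intro n hn
      have hn' : (N : ℤ) ≤ n := by simpa using hn
      lift n to ℕ using (Int.natCast_nonneg N).trans hn'
      exact hN n (by exact_mod_cast hn')
    | succ m ih =>
      intro n hn
      -- In the vanishing difference of order `natDegree + 1`, the value at `n` has coefficient
      -- $\pm1$ and all others are values at larger integers.
      have h1 := congrFun (p.fwdDiff_iter_degree_add_one_eq_zero) (n : ℚ)
      rw [fwdDiff_iter_eq_sum_shift, Finset.sum_range_succ', Pi.zero_apply] at h1
      choose f hf using fun j : ℕ => ih (n + ((j + 1 : ℕ) : ℤ)) (by push_cast at hn ⊢; linarith)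
      have h2 : ∀ j : ℕ, p.eval ((n : ℚ) + (j + 1) • (1 : ℚ)) = f j := by
        intro j
        rw [← hf j]
        push_cast
        simp
      simp only [h2, zero_smul, add_zero, Nat.choose_zero_right, Nat.sub_zero, Nat.cast_one,
        mul_one, zsmul_eq_mul] at h1
      set T : ℤ := ∑ j ∈ Finset.range (p.natDegree + 1),
        (-1) ^ (p.natDegree + 1 - (j + 1)) * ((p.natDegree + 1).choose (j + 1) : ℤ) * f j with hT
      refine ⟨-((-1) ^ (p.natDegree + 1) * T), ?_⟩
      have h3 : (T : ℚ) + (-1) ^ (p.natDegree + 1) * p.eval (n : ℚ) = 0 := by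
        rw [← h1, hT]
        push_cast
        rfl
      have h4 : ((-1 : ℚ) ^ (p.natDegree + 1)) * (-1) ^ (p.natDegree + 1) = 1 := by
        rw [← mul_pow]; norm_num
      push_cast
      linear_combination (-1 : ℚ) ^ (p.natDegree + 1) * h3 - p.eval (n : ℚ) * h4
  exact h (N + n.natAbs) n (by push_cast; have := abs_nonneg n; have := neg_abs_le n; linarith)

end IntegerValued

/-! ### Degree from growth -/

section Growth

open Polynomial

theorem degree_le_of_eventually_le {p : ℚ[X]} {d N : ℕ} {K : ℚ}
    (h : ∀ n : ℕ, N ≤ n → p.eval (n : ℚ) ≤ K * (n + 1) ^ d)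
    (h0 : ∀ n : ℕ, N ≤ n → 0 ≤ p.eval (n : ℚ)) : p.degree ≤ d := by
  by_contra! hlt
  have hpos : 0 < p.degree := lt_of_le_of_lt (by exact_mod_cast Nat.zero_le d) hlt
  set q : ℚ[X] := C K * (X + 1) ^ d with hq
  have hqd : q.degree < p.degree := by
    refine lt_of_le_of_lt ?_ hlt
    have h1 : (C K : ℚ[X]).degree ≤ 0 := degree_C_le
    have h2 : ((X + 1 : ℚ[X]) ^ d).degree ≤ d := by
      refine (degree_pow_le _ _).trans ?_
      rw [← C_1, degree_X_add_C]
      simp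
    rw [hq]
    exact (degree_mul_le _ _).trans (by simpa using add_le_add h1 h2)
  -- If the degree exceeds `d`, a nonnegative leading coefficient violates the upper bound and a
  -- nonpositive one violates nonnegativity.
  rcases le_total 0 p.leadingCoeff with hl | hl
  · have ht := tendsto_atTop_of_leadingCoeff_nonneg (p - q)
      (by rwa [degree_sub_eq_left_of_degree_lt hqd])
      (by rwa [leadingCoeff_sub_of_degree_lt hqd])
    have ht' := ht.comp (tendsto_natCast_atTop_atTop (R := ℚ))
    obtain ⟨n, h1, h2⟩ := ((ht'.eventually_gt_atTop 0).and (eventually_ge_atTop N)).exists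
    have h3 := h n h2
    simp [hq] at h1
    linarith
  · have ht := tendsto_atBot_of_leadingCoeff_nonpos p hpos hl
    have ht' := ht.comp (tendsto_natCast_atTop_atTop (R := ℚ))
    obtain ⟨n, h1, h2⟩ := ((ht'.eventually_lt_atBot 0).and (eventually_ge_atTop N)).exists
    exact absurd h1 (not_lt.2 (h0 n h2))

theorem le_degree_of_eventually_ge {p : ℚ[X]} {d N : ℕ} {r : ℝ} (hr : 0 < r)
    (h : ∀ n : ℕ, N ≤ n → (r * n - 1) ^ d ≤ (p.eval (n : ℚ) : ℚ)) : (d : WithBot ℕ) ≤ p.degree := by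
  by_contra! hlt
  -- For `d = 0` the growth argument gives nothing; the bound then reads $1\le p(n)$ and rules out
  -- `p = 0`.
  rcases Nat.eq_zero_or_pos d with rfl | hd
  · have hp : p = 0 := by
      rw [← degree_eq_bot]
      rw [Nat.cast_zero, Nat.WithBot.lt_zero_iff] at hlt
      exact hlt
    have := h N le_rfl
    simp [hp] at this
    linarith
  set P : ℝ[X] := p.map (algebraMap ℚ ℝ) with hP
  set q : ℝ[X] := (C r * X - C 1) ^ d with hq
  have hlin : (C r * X - C 1 : ℝ[X]).degree = 1 := by
    rw [sub_eq_add_neg, ← C_neg]; exact degree_linear hr.ne'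
  have hlc : (C r * X - C 1 : ℝ[X]).leadingCoeff = r := by
    rw [sub_eq_add_neg, ← C_neg]; exact leadingCoeff_linear hr.ne'
  have hqd : q.degree = d := by rw [hq, degree_pow, hlin]; simp
  have hPq : P.degree < q.degree := by rwa [hqd, hP, degree_map]
  have ht := tendsto_atTop_of_leadingCoeff_nonneg (q - P)
    (by rw [degree_sub_eq_left_of_degree_lt hPq, hqd]; exact_mod_cast hd)
    (by rw [leadingCoeff_sub_of_degree_lt hPq, hq, leadingCoeff_pow, hlc]; positivity)
  have ht' := ht.comp (tendsto_natCast_atTop_atTop (R := ℝ))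
  obtain ⟨n, h1, h2⟩ := ((ht'.eventually_gt_atTop 0).and (eventually_ge_atTop N)).exists
  have h3 := h n h2
  have h4 : P.eval (n : ℝ) = (p.eval (n : ℚ) : ℚ) := by
    rw [hP, ← Rat.cast_natCast, ← eq_ratCast (algebraMap ℚ ℝ), eval_map_apply]
    simp
  simp only [Function.comp, eval_sub, h4] at h1
  simp [hq] at h1
  linarith

end Growth

/-! ### Dual lattice bases and generic one-parameter subgroups -/

namespace ToricFan

variable {d : ℕ}

/-- The dual basis of a lattice basis, as vectors. -/
noncomputable def dualVec (b : Module.Basis (Fin d) ℤ (Fin d → ℤ)) (i : Fin d) : Fin d → ℤ :=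
  fun k => b.repr (Pi.single k 1) i

theorem dualVec_dotProduct (b : Module.Basis (Fin d) ℤ (Fin d → ℤ)) (i : Fin d)
    (v : Fin d → ℤ) : dualVec b i ⬝ᵥ v = b.repr v i := by
  have h := coord_latticePt b i v
  rw [coord_apply] at h
  rw [dotProduct_comm]
  simp only [latticePt] at h
  exact_mod_cast h

theorem dualVec_ne_zero (b : Module.Basis (Fin d) ℤ (Fin d → ℤ)) (i : Fin d) :
    dualVec b i ≠ 0 := by
  intro h
  have := dualVec_dotProduct b i (b i)
  simp [h] at this

theorem sum_smul_dualVec (b : Module.Basis (Fin d) ℤ (Fin d → ℤ)) (u : Fin d → ℤ) :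
    ∑ i, (u ⬝ᵥ b i) • dualVec b i = u := by
  ext k
  have h1 : u k = u ⬝ᵥ Pi.single k 1 := by simp
  have h2 : (Pi.single k 1 : Fin d → ℤ) = ∑ i, b.repr (Pi.single k 1) i • b i :=
    (b.sum_repr _).symm
  rw [h1, h2, dotProduct_sum, Finset.sum_apply]
  refine Finset.sum_congr rfl fun i _ => ?_
  rw [dotProduct_smul, Pi.smul_apply, smul_eq_mul, smul_eq_mul, mul_comm]
  rfl

/-- Pairing with a lattice vector. -/
def pairing (v : Fin d → ℤ) : (Fin d → ℤ) →+ ℤ where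
  toFun u := u ⬝ᵥ v
  map_zero' := zero_dotProduct v
  map_add' u w := add_dotProduct u w v

theorem exists_pairing_ne_zero (W : Finset (Fin d → ℤ)) (hW : ∀ w ∈ W, w ≠ 0) :
    ∃ v : Fin d → ℤ, ∀ w ∈ W, pairing v w ≠ 0 := by
  classical
  induction W using Finset.induction_on with
  | empty => exact ⟨0, by simp⟩
  | insert w W hw ih =>
    obtain ⟨v, hv⟩ := ih fun w hw => hW w (Finset.mem_insert_of_mem hw)
    have hw0 : w ⬝ᵥ w ≠ 0 := fun h => hW w (Finset.mem_insert_self _ _) (dotProduct_self_eq_zero.1 h)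
    -- The new vector is sought as `w + k • v`. The disjunction discards vectors orthogonal to both
    -- `w` and `v`, so each `x` excludes at most one `k`.
    have hfin : {k : ℤ | ∃ x ∈ insert w W, x ⬝ᵥ w + k * (x ⬝ᵥ v) = 0 ∧ (x ⬝ᵥ w ≠ 0 ∨ x ⬝ᵥ v ≠ 0)
        }.Finite := by
      have : {k : ℤ | ∃ x ∈ insert w W, x ⬝ᵥ w + k * (x ⬝ᵥ v) = 0 ∧
          (x ⬝ᵥ w ≠ 0 ∨ x ⬝ᵥ v ≠ 0)} ⊆ ⋃ x ∈ insert w W,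
          {k : ℤ | x ⬝ᵥ w + k * (x ⬝ᵥ v) = 0 ∧ (x ⬝ᵥ w ≠ 0 ∨ x ⬝ᵥ v ≠ 0)} := by
        rintro k ⟨x, hx, h⟩
        exact Set.mem_biUnion (Finset.mem_coe.2 hx) h
      refine ((insert w W).finite_toSet.biUnion fun x _ => ?_).subset this
      refine Set.Subsingleton.finite ?_
      rintro k ⟨h1, h2⟩ k' ⟨h1', -⟩
      by_cases hxv : x ⬝ᵥ v = 0
      · simp [hxv] at h1 h2
        exact absurd h1 h2
      · exact mul_right_cancel₀ hxv (by linarith)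
    obtain ⟨k, hk⟩ := hfin.exists_notMem
    refine ⟨w + k • v, fun x hx h => hk ⟨x, hx, ?_, ?_⟩⟩
    · have : x ⬝ᵥ (w + k • v) = 0 := h
      rwa [dotProduct_add, dotProduct_smul, smul_eq_mul] at this
    · rcases Finset.mem_insert.1 hx with rfl | hx
      · exact Or.inl hw0
      · exact Or.inr (hv x hx)

end ToricFan

/-! ### Growth and polynomiality of the number of sections -/

namespace TropicalToricVectorBundle

open ToricFan

variable {d : ℕ} {S : ToricFan d} {α : Type*} [Fintype α] {𝓜 : Matroid α}
  {β : PointedCone ℝ (Fin d → ℝ) → Module.Basis (Fin d) ℤ (Fin d → ℤ)}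
  {E : TropicalToricVectorBundle S 𝓜} {A : PointedCone ℝ (Fin d → ℝ) → Set α}
  {L : ToricLineBundle S} {m : PointedCone ℝ (Fin d → ℝ) → Fin d → ℝ} {C : ℝ}

theorem h0Weight_le_card (E : TropicalToricVectorBundle S 𝓜) (u : Fin d → ℤ) :
    E.h0Weight u ≤ Fintype.card α := by
  refine ENat.toNat_le_of_le_natCast ?_
  rw [globalSections, Matroid.eRank_restrict]
  refine (𝓜.eRk_le_encard _).trans ((Set.encard_mono (Set.subset_univ _)).trans ?_)
  simp

theorem one_le_h0Weight [Nonempty α] (hground : 𝓜.E = Set.univ) (hloopless : 𝓜.Loopless)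
    {E : TropicalToricVectorBundle S 𝓜} {u : Fin d → ℤ}
    (h : ∀ e, latticePt u ∈ E.polyhedron e) : 1 ≤ E.h0Weight u := by
  obtain ⟨e⟩ := ‹Nonempty α›
  have he : 𝓜.Indep {e} := by
    rw [Matroid.indep_singleton]
    exact Matroid.isNonloop_of_loopless (by simp [hground])
  have h1 : (1 : ℕ∞) ≤ (E.globalSections u).eRank := by
    rw [globalSections, Matroid.eRank_restrict, ← Set.encard_singleton e]
    exact he.encard_le_eRk_of_subset (by simp [hground, h])
  have h2 : (E.globalSections u).eRank ≠ ⊤ := by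
    rw [globalSections, Matroid.eRank_restrict]
    exact ((𝓜.eRk_le_encard _).trans_lt (Set.toFinite _).encard_lt_top).ne
  exact ENat.toNat_le_toNat h1 h2

/-- The weights of the global sections of the twists lie in boxes of linearly growing size. -/
theorem exists_box (hβ : S.IsFrame β) (hc : S.IsComplete) (hm : L.IsVertexChoice m)
    (hC : E.IsBound C) : ∃ c : ℕ, ∀ (n : ℕ) (u : Fin d → ℤ),
      (E.tensor (L.pow n)).h0Weight u ≠ 0 →
      u ∈ Finset.Icc (fun _ => -(c * (n + 1) : ℤ)) (fun _ => (c * (n + 1) : ℤ)) := by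
  have hz : ∀ z : Fin d → ℤ, ∃ c : ℕ, ∀ (n : ℕ) (u : Fin d → ℤ),
      (E.tensor (L.pow n)).h0Weight u ≠ 0 → u ⬝ᵥ z ≤ c * (n + 1) := by
    intro z
    obtain ⟨c, hc'⟩ := exists_nat_ge (|L.psi (latticePt z)| + C * frameNorm S β (latticePt z))
    refine ⟨c, fun n u hu => ?_⟩
    have h1 : -C * frameNorm S β (latticePt z) ≤ excess L n u (latticePt z) := by
      by_contra! hlt
      exact hu (h0Weight_eq_zero_of_excess_lt hβ hc hm hC hlt)
    rw [excess, latticePt_dotProduct] at h1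
    have h2 := mul_le_mul_of_nonneg_right hc' (by positivity : (0 : ℝ) ≤ n + 1)
    have h3 := mul_le_mul_of_nonneg_left (le_abs_self (L.psi (latticePt z)))
      (Nat.cast_nonneg (α := ℝ) n)
    have h4 : 0 ≤ n * (C * frameNorm S β (latticePt z)) :=
      mul_nonneg (Nat.cast_nonneg n) (mul_nonneg hC.1 (frameNorm_nonneg _))
    have h5 : ((u ⬝ᵥ z : ℤ) : ℝ) ≤ c * (n + 1) := by
      have := abs_nonneg (L.psi (latticePt z))
      nlinarith
    exact_mod_cast h5
  choose f hf using hz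
  refine ⟨∑ k, (f (Pi.single k 1) + f (-Pi.single k 1)), fun n u hu => ?_⟩
  have hle : ∀ k : Fin d, f (Pi.single k 1) + f (-Pi.single k 1) ≤
      ∑ k, (f (Pi.single k 1) + f (-Pi.single k 1)) := fun k =>
    Finset.single_le_sum (f := fun k => f (Pi.single k 1) + f (-Pi.single k 1))
      (fun _ _ => Nat.zero_le _) (Finset.mem_univ k)
  have hn : (0 : ℤ) ≤ n + 1 := by positivity
  rw [Finset.mem_Icc]
  refine ⟨fun k => ?_, fun k => ?_⟩
  · have h1 := hf (-Pi.single k 1) n u hu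
    rw [dotProduct_neg, dotProduct_single, mul_one] at h1
    have h2 : (f (-Pi.single k 1) : ℤ) ≤
        ((∑ k, (f (Pi.single k 1) + f (-Pi.single k 1)) : ℕ) : ℤ) := by
      exact_mod_cast (Nat.le_add_left _ _).trans (hle k)
    have h3 := mul_le_mul_of_nonneg_right h2 hn
    simp only
    linarith
  · have h1 := hf (Pi.single k 1) n u hu
    rw [dotProduct_single, mul_one] at h1
    have h2 : (f (Pi.single k 1) : ℤ) ≤
        ((∑ k, (f (Pi.single k 1) + f (-Pi.single k 1)) : ℕ) : ℤ) := by
      exact_mod_cast (Nat.le_add_right _ _).trans (hle k)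
    have h3 := mul_le_mul_of_nonneg_right h2 hn
    simp only
    linarith

theorem finite_weights {n c : ℕ}
    (hbox : ∀ u : Fin d → ℤ, E.h0Weight u ≠ 0 →
      u ∈ Finset.Icc (fun _ => -(c * (n + 1) : ℤ)) (fun _ => (c * (n + 1) : ℤ))) :
    {u : Fin d → ℤ | E.h0Weight u ≠ 0}.Finite :=
  (Finset.finite_toSet _).subset hbox

theorem h0_le_of_box {n c : ℕ}
    (hbox : ∀ u : Fin d → ℤ, E.h0Weight u ≠ 0 →
      u ∈ Finset.Icc (fun _ => -(c * (n + 1) : ℤ)) (fun _ => (c * (n + 1) : ℤ))) :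
    E.h0 ≤ (Fintype.card α * (2 * c + 1) ^ d) * (n + 1) ^ d := by
  rw [h0, finsum_eq_sum_of_support_subset _ (s := Finset.Icc _ _) hbox]
  refine (Finset.sum_le_card_nsmul _ _ _ fun u _ => E.h0Weight_le_card u).trans ?_
  rw [Pi.card_Icc]
  simp only [Int.card_Icc, Finset.prod_const, Finset.card_univ, Fintype.card_fin, smul_eq_mul]
  rw [mul_comm, mul_assoc, ← mul_pow]
  refine Nat.mul_le_mul_left _ (Nat.pow_le_pow_left ?_ d)
  rw [Int.toNat_le]
  push_cast
  nlinarith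

/-- The number of global sections of the twists grows at least like `n ^ d`. -/
theorem exists_le_h0 [Nonempty α] (hground : 𝓜.E = Set.univ) (hloopless : 𝓜.Loopless)
    (hfin : S.rays.Finite) (hC : E.IsBound C) (hL : L.IsAmple)
    (hfw : ∀ n : ℕ, {u : Fin d → ℤ | (E.tensor (L.pow n)).h0Weight u ≠ 0}.Finite) :
    ∃ r : ℝ, 0 < r ∧ ∃ N : ℕ, ∀ n : ℕ, N ≤ n →
      (r * n - 1) ^ d ≤ ((E.tensor (L.pow n)).h0 : ℝ) := by
  classical
  obtain ⟨y, ε, hε, hy⟩ := hL.exists_interior hfin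
  set V : ℝ := ∑ v ∈ hfin.toFinset, ∑ k, |latticePt v k| with hV
  have hV0 : 0 ≤ V := Finset.sum_nonneg fun _ _ => Finset.sum_nonneg fun _ _ => abs_nonneg _
  -- Moving each coordinate of `n • y` by at most `r * n` changes the pairing with a ray by at most
  -- `n * ε / 2`. The other half of the slack `n * ε` absorbs `C` once `n ≥ N`.
  set r : ℝ := ε / (2 * (V + 1)) with hr
  have hr0 : 0 < r := by positivity
  have hrV : r * V ≤ ε / 2 := by
    rw [hr, div_mul_eq_mul_div, div_le_div_iff₀ (by positivity) (by norm_num)]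
    nlinarith
  obtain ⟨N, hN⟩ := exists_nat_ge (2 * C / ε + 1 / r)
  refine ⟨r, hr0, N, fun n hn => ?_⟩
  have hnN : 2 * C / ε + 1 / r ≤ n := hN.trans (by exact_mod_cast hn)
  have hC0 := hC.1
  have hn1 : C ≤ n * (ε / 2) := by
    have h1 : 2 * C / ε ≤ n := by
      have : 0 < 1 / r := by positivity
      linarith
    rw [div_le_iff₀ hε] at h1
    linarith
  have hn2 : 1 ≤ r * n := by
    have h1 : 1 / r ≤ n := by
      have : 0 ≤ 2 * C / ε := by positivity
      linarith
    rw [div_le_iff₀ hr0] at h1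
    linarith
  set K : ℕ := ⌊r * n⌋₊ with hK
  have hKle : (K : ℝ) ≤ r * n := Nat.floor_le (by linarith)
  have hKge : r * n - 1 ≤ K := (Nat.sub_one_lt_floor _).le
  -- A cube of `K ^ d` lattice points: the `k`-th coordinate exceeds `n * y k` by at most `j k + 1 ≤
  -- K ≤ r * n`.
  let g : (Fin d → Fin K) → Fin d → ℤ := fun j k => ⌊n * y k⌋ + 1 + (j k : ℕ)
  have hg : Function.Injective g := by
    intro j j' h
    ext k
    have := congrFun h k
    simpa [g] using this
  have hone : ∀ j, 1 ≤ (E.tensor (L.pow n)).h0Weight (g j) := by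
    intro j
    refine one_le_h0Weight hground hloopless fun e v hv => ?_
    rw [le_tensor_pow_iff, excess]
    have h1 := (abs_le.1 (hC.2 v hv e)).1
    have h2 : latticePt (g j) ⬝ᵥ latticePt v ≤ n * (y ⬝ᵥ latticePt v) + r * n * V := by
      have h3 : ∀ k, latticePt (g j) k * latticePt v k ≤
          n * (y k * latticePt v k) + r * n * |latticePt v k| := by
        intro k
        have h4 : |latticePt (g j) k - n * y k| ≤ r * n := by
          have hj : ((j k : ℕ) : ℝ) + 1 ≤ K := by exact_mod_cast (j k).2
          have hf1 := Int.floor_le ((n : ℝ) * y k)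
          have hf2 := Int.lt_floor_add_one ((n : ℝ) * y k)
          have hj0 : (0 : ℝ) ≤ ((j k : ℕ) : ℝ) := Nat.cast_nonneg _
          have : latticePt (g j) k = (⌊n * y k⌋ : ℝ) + 1 + ((j k : ℕ) : ℝ) := by
            simp [latticePt, g]
          rw [this, abs_le]
          constructor <;> linarith
        have h5 : (latticePt (g j) k - n * y k) * latticePt v k ≤
            r * n * |latticePt v k| := by
          refine (le_abs_self _).trans ?_
          rw [abs_mul]
          exact mul_le_mul_of_nonneg_right h4 (abs_nonneg _)
        linarith
      have h6 := Finset.sum_le_sum fun k (_ : k ∈ Finset.univ) => h3 k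
      rw [Finset.sum_add_distrib, ← Finset.mul_sum, ← Finset.mul_sum] at h6
      refine le_trans h6 (add_le_add le_rfl (mul_le_mul_of_nonneg_left ?_ (by linarith)))
      exact Finset.single_le_sum (f := fun v => ∑ k, |latticePt v k|)
        (fun _ _ => Finset.sum_nonneg fun _ _ => abs_nonneg _) (hfin.mem_toFinset.2 hv)
    have h7 := mul_le_mul_of_nonneg_left (hy v hv) (Nat.cast_nonneg (α := ℝ) n)
    have h8 := mul_le_mul_of_nonneg_left hrV (Nat.cast_nonneg (α := ℝ) n)
    linarith
  have hcard : K ^ d ≤ (E.tensor (L.pow n)).h0 := by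
    rw [h0, finsum_eq_sum_of_support_subset _ (s := (hfw n).toFinset) (by simp [Function.support])]
    have hsub : Finset.univ.image g ⊆ (hfw n).toFinset := by
      intro u hu
      obtain ⟨j, -, rfl⟩ := Finset.mem_image.1 hu
      rw [Set.Finite.mem_toFinset]
      exact Nat.one_le_iff_ne_zero.1 (hone j)
    calc K ^ d = (Finset.univ.image g).card := by
          rw [Finset.card_image_of_injective _ hg]; simp
      _ = ∑ u ∈ Finset.univ.image g, 1 := by simp
      _ ≤ ∑ u ∈ Finset.univ.image g, (E.tensor (L.pow n)).h0Weight u := by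
          refine Finset.sum_le_sum fun u hu => ?_
          obtain ⟨j, -, rfl⟩ := Finset.mem_image.1 hu
          exact hone j
      _ ≤ _ := Finset.sum_le_sum_of_subset hsub
  calc (r * n - 1) ^ d ≤ (K : ℝ) ^ d := pow_le_pow_left₀ (by linarith) hKge d
    _ ≤ _ := by exact_mod_cast hcard

/-- The difference operators of the edges of a unimodular cone turn the (signed, half-open)
indicator function of a flip of the cone into that of its apex. -/
theorem translationAction_flipped_cone (b : Module.Basis (Fin d) ℤ (Fin d → ℤ))
    (pos : Fin d → Prop) [DecidablePred pos] (c : Fin d → ℤ) :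
    translationAction (Fin d → ℤ) (∏ i, (1 - AddMonoidAlgebra.single (-dualVec b i) 1))
      (fun u => ∏ i, (if pos i then (if u ⬝ᵥ b i ≤ c i then 0 else -1)
        else (if u ⬝ᵥ b i ≤ c i then 1 else 0))) =
      fun u => (AddMonoidAlgebra.single (∑ i, c i • dualVec b i) 1 :
        AddMonoidAlgebra ℤ (Fin d → ℤ)).coeff u := by
  classical
  have hk : ∀ i j, pairing (b j) (dualVec b i) = if i = j then 1 else 0 := by
    intro i j
    have h : pairing (b j) (dualVec b i) = dualVec b i ⬝ᵥ b j := rfl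
    rw [h, dualVec_dotProduct, b.repr_self, Finsupp.single_apply]
    simp only [eq_comm]
  have h := translationAction_prod Finset.univ Finset.univ subset_rfl (fun i => pairing (b i))
    (dualVec b) hk (fun i k => if pos i then (if k ≤ c i then 0 else -1)
        else (if k ≤ c i then 1 else 0))
  refine h.trans ?_
  ext u
  -- Both one-dimensional functions, of values `1, 0` and `0, -1`, drop by one exactly after `c i`,
  -- so they have the same difference whatever `pos` is.
  have h1 : ∀ i, (if i ∈ (Finset.univ : Finset (Fin d)) then
      (if pos i then (if pairing (b i) u ≤ c i then 0 else -1)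
        else (if pairing (b i) u ≤ c i then 1 else 0)) -
      (if pos i then (if pairing (b i) u + 1 ≤ c i then 0 else -1)
        else (if pairing (b i) u + 1 ≤ c i then 1 else 0)) else
      (if pos i then (if pairing (b i) u ≤ c i then 0 else -1)
        else (if pairing (b i) u ≤ c i then 1 else 0)) : ℤ) =
      if u ⬝ᵥ b i = c i then 1 else 0 := by
    intro i
    have h : pairing (b i) u = u ⬝ᵥ b i := rfl
    rw [if_pos (Finset.mem_univ i), h]
    split_ifs <;> first | rfl | omega
  simp only [h1]
  rw [AddMonoidAlgebra.coeff_single, Finsupp.single_apply]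
  split_ifs with hu
  · subst hu
    refine Finset.prod_eq_one fun j _ => if_pos ?_
    rw [sum_dotProduct, Finset.sum_eq_single j]
    · rw [smul_dotProduct, dualVec_dotProduct]; simp
    · intro i _ hij
      rw [smul_dotProduct, dualVec_dotProduct, b.repr_self, Finsupp.single_eq_of_ne hij, smul_zero]
    · simp
  · obtain ⟨i, hi⟩ : ∃ i, u ⬝ᵥ b i ≠ c i := by
      by_contra! hcon
      refine hu ?_
      rw [← sum_smul_dualVec b u]
      exact Finset.sum_congr rfl fun i _ => by rw [hcon i]
    exact Finset.prod_eq_zero (Finset.mem_univ i) (if_neg hi)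

theorem exists_polynomial_h0 (hβ : S.IsFrame β) (hs : S.IsSmooth) (hc : S.IsComplete)
    (hA : E.IsApartmentChoice A) (hground : 𝓜.E = Set.univ) {N₀ : ℕ}
    (hN₀ : ∀ n : ℕ, N₀ ≤ n → ∀ u : Fin d → ℤ,
      (E.tensor (L.pow n)).eulerChar u = (E.tensor (L.pow n)).h0Weight u)
    (hfw : ∀ n : ℕ, {u : Fin d → ℤ | (E.tensor (L.pow n)).h0Weight u ≠ 0}.Finite) :
    ∃ p : Polynomial ℚ, ∀ n : ℕ, N₀ ≤ n → ((E.tensor (L.pow n)).h0 : ℚ) = p.eval (n : ℚ) := by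
  classical
  choose cE hcE using fun v => E.integral v (hc _)
  choose cL hcL using fun v => L.integral v (hc _)
  obtain ⟨ξ, hξ⟩ := S.exists_generic
  -- `η` pairs to a nonzero integer with every edge direction, so the common denominator stays
  -- nonzero under evaluation.
  obtain ⟨η, hη⟩ := exists_pairing_ne_zero
    (S.maxCones.biUnion fun σ => Finset.univ.image (dualVec (β σ))) (by
      intro w hw
      obtain ⟨σ, -, hw⟩ := Finset.mem_biUnion.1 hw
      obtain ⟨i, -, rfl⟩ := Finset.mem_image.1 hw
      exact dualVec_ne_zero _ _)
  let D : PointedCone ℝ (Fin d → ℝ) → AddMonoidAlgebra ℤ (Fin d → ℤ) := fun σ =>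
    ∏ i, (1 - AddMonoidAlgebra.single (-dualVec (β σ) i) 1)
  let ev := evalOneAddX (pairing η)
  have hD : ev (∏ σ ∈ S.maxCones, D σ) ≠ 0 := by
    rw [map_prod]
    refine Finset.prod_ne_zero_iff.2 fun σ hσ => ?_
    rw [map_prod]
    refine Finset.prod_ne_zero_iff.2 fun i _ => ?_
    rw [map_sub, map_one, evalOneAddX_single]
    refine one_sub_binomialSeries_ne_zero ?_
    rw [map_neg, neg_ne_zero]
    exact hη _ (Finset.mem_biUnion.2 ⟨σ, hσ, Finset.mem_image_of_mem _ (Finset.mem_univ i)⟩)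
  let J : Finset (Σ _ : PointedCone ℝ (Fin d → ℝ), α) :=
    S.maxCones.sigma fun σ => Finset.univ.filter fun e => e ∈ A σ
  obtain ⟨p, hp⟩ := exists_polynomial_constantCoeff J hD
    (fun j => ev (∏ τ ∈ S.maxCones.erase j.1, D τ))
    (fun j => ∑ i, cE (β j.1 i) j.2 * pairing η (dualVec (β j.1) i))
    (fun j => ∑ i, cL (β j.1 i) * pairing η (dualVec (β j.1) i))
  refine ⟨p, fun n hn => ?_⟩
  let H : AddMonoidAlgebra ℤ (Fin d → ℤ) := AddMonoidAlgebra.ofCoeff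
    (Finsupp.ofSupportFinite (fun u => ((E.tensor (L.pow n)).h0Weight u : ℤ))
      ((hfw n).subset fun u hu => by simpa using hu))
  have hH : ∀ u, H.coeff u = ((E.tensor (L.pow n)).h0Weight u : ℤ) := fun u => rfl
  -- The apex of the flipped cone for `σ` and `e`; its dependence on `n` is affine, which makes the
  -- exponents after evaluation affine in `n`.
  let apex : PointedCone ℝ (Fin d → ℝ) → α → Fin d → ℤ := fun σ e =>
    ∑ i, (cE (β σ i) e + n * cL (β σ i)) • dualVec (β σ) i
  have hsum : (fun u => H.coeff u) = ∑ j ∈ J, fun u : Fin d → ℤ => ∏ i,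
      (if 0 < coord (β j.1) i ξ then
        (if u ⬝ᵥ β j.1 i ≤ cE (β j.1 i) j.2 + n * cL (β j.1 i) then 0 else -1)
      else (if u ⬝ᵥ β j.1 i ≤ cE (β j.1 i) j.2 + n * cL (β j.1 i) then 1 else 0) : ℤ) := by
    ext u
    rw [hH, ← hN₀ n hn, eulerChar_eq_sum_maxCones hβ (hA.tensor (L.pow n)) hground hs hc hξ,
      Finset.sum_apply, Finset.sum_sigma]
    refine Finset.sum_congr rfl fun σ _ => Finset.sum_congr rfl fun e _ =>
      Finset.prod_congr rfl fun i _ => ?_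
    have hiff : latticePt u ⬝ᵥ latticePt (β σ i) ≤
        (E.tensor (L.pow n)).Phi (latticePt (β σ i)) e ↔
        u ⬝ᵥ β σ i ≤ cE (β σ i) e + n * cL (β σ i) := by
      have h : (E.tensor (L.pow n)).Phi (latticePt (β σ i)) e =
          E.Phi (latticePt (β σ i)) e + n * L.psi (latticePt (β σ i)) := rfl
      rw [h, hcE, hcL, latticePt_dotProduct]
      exact_mod_cast Iff.rfl
    simp only [hiff]
  -- The factor `D j.1` collapses the flipped cone to its apex, and the remaining factors multiply
  -- the resulting monomial.
  have hDH : (∏ σ ∈ S.maxCones, D σ) * H =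
      ∑ j ∈ J, (∏ τ ∈ S.maxCones.erase j.1, D τ) * AddMonoidAlgebra.single (apex j.1 j.2) 1 := by
    ext u
    have h1 := congrFun (translationAction_coeff (∏ σ ∈ S.maxCones, D σ) H) u
    rw [← h1, hsum, map_sum, Finset.sum_apply, AddMonoidAlgebra.coeff_sum, Finsupp.finsetSum_apply]
    refine Finset.sum_congr rfl fun j hj => ?_
    rw [← Finset.mul_prod_erase _ _ (Finset.mem_sigma.1 hj).1, mul_comm (D j.1), map_mul,
      Module.End.mul_apply, translationAction_flipped_cone, translationAction_coeff]
  have h := hp n (ev H) ?_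
  · rw [h, constantCoeff_evalOneAddX, h0,
      finsum_eq_sum_of_support_subset _ (s := H.coeff.support) ?_]
    · rw [Nat.cast_sum]
      exact Finset.sum_congr rfl fun u _ => by rw [hH, Int.cast_natCast]
    · intro u hu
      rw [Finset.mem_coe, Finsupp.mem_support_iff, hH]
      exact_mod_cast hu
  · rw [← map_mul, hDH, map_sum]
    refine Finset.sum_congr rfl fun j _ => ?_
    rw [map_mul, evalOneAddX_single]
    congr 2
    simp only [apex, map_sum, map_zsmul, smul_eq_mul, add_mul, Finset.sum_add_distrib,
      Finset.mul_sum, mul_assoc]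

end TropicalToricVectorBundle

/-! ### The theorem -/

open ToricFan TropicalToricVectorBundle

theorem theorem6p10 {d : ℕ} (S : ToricFan d) (hsmooth : S.IsSmooth) (hproj : S.IsProjective)
    {α : Type*} [Fintype α] [Nonempty α] (𝓜 : Matroid α) (hground : 𝓜.E = Set.univ)
    (hloopless : 𝓜.Loopless)
    (E : TropicalToricVectorBundle S 𝓜) (L : ToricLineBundle S) (hL : L.IsAmple) :
    ∃ N₀ : ℕ, 0 < N₀ ∧
      (∀ N : ℕ, N₀ ≤ N → ∀ u : Fin d → ℤ,
        (E.tensor (L.pow N)).eulerChar u = ((E.tensor (L.pow N)).h0Weight u : ℤ)) ∧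
      (∀ N : ℕ, N₀ ≤ N → {u : Fin d → ℤ | (E.tensor (L.pow N)).h0Weight u ≠ 0}.Finite) ∧
      ∃ p : Polynomial ℚ, p.degree = (d : WithBot ℕ) ∧
        (∀ n : ℤ, ∃ k : ℤ, p.eval (n : ℚ) = (k : ℚ)) ∧
        ∀ N : ℕ, N₀ ≤ N → ((E.tensor (L.pow N)).h0 : ℚ) = p.eval (N : ℚ) := by
  have hc := hproj.1
  obtain ⟨β, hβ⟩ := hsmooth.exists_isFrame
  obtain ⟨A, hA⟩ := E.exists_isApartmentChoice
  have hfin := hβ.finite_rays hc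
  obtain ⟨m, hm⟩ := hL.exists_isVertexChoice hsmooth hc hβ
  obtain ⟨C, hC⟩ := E.exists_isBound hfin
  obtain ⟨N₀, hpos, hχ⟩ := exists_eulerChar_eq_h0Weight hβ hsmooth hc hA hground hm hC
  obtain ⟨c, hbox⟩ := exists_box hβ hc hm hC
  have hfw := fun n => finite_weights (hbox n)
  obtain ⟨p, hp⟩ := exists_polynomial_h0 hβ hsmooth hc hA hground hχ hfw
  obtain ⟨r, hr, N₁, hlow⟩ := exists_le_h0 hground hloopless hfin hC hL hfw
  refine ⟨N₀, hpos, hχ, fun n _ => hfw n, p, le_antisymm ?_ ?_, ?_, hp⟩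
  · refine degree_le_of_eventually_le (N := N₀)
      (K := ((Fintype.card α * (2 * c + 1) ^ d : ℕ) : ℚ)) (fun n hn => ?_) fun n hn => ?_
    · rw [← hp n hn]
      exact_mod_cast h0_le_of_box (hbox n)
    · rw [← hp n hn]
      exact Nat.cast_nonneg _
  · refine le_degree_of_eventually_ge (N := max N₀ N₁) hr fun n hn => ?_
    rw [← hp n ((le_max_left _ _).trans hn), Rat.cast_natCast]
    exact hlow n ((le_max_right _ _).trans hn)
  · exact exists_int_eval_of_eventually (N := N₀) fun n hn =>
      ⟨((E.tensor (L.pow n)).h0 : ℤ), by rw [← hp n hn, Int.cast_natCast]⟩
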